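/- For each $n\ge 2$ let $p=p_n\ge 1$ be an integer and let $\mathbf X_1,\dots,\mathbf X_n$ be independent random points, each uniformly distributed on the unit sphere $\mathbb S^{p-1}$ of $\mathbb R^{p}$. For $1\le i<j\le n$ let $\Theta_{ij}\in[0,\pi]$ be the angle between the vectors $\mathbf X_i$ and $\mathbf X_j$, and put $\Theta_{\min}=\min_{1\le i<j\le n}\Theta_{ij}$ and $\Theta_{\max}=\max_{1\le i<j\le n}\Theta_{ij}$. Assume that $\frac{\log n}{p_n}\to\infty$ as $n\to\infty$. Then the following hold. (i) $\Theta_{\min}\to 0$ and $\Theta_{\max}\to\pi$ in probability as $n\to\infty$. (ii) If in addition $p_n\to\infty$, then, as $n\to\infty$, $2p\log\sin\Theta_{\min}+\frac{4p}{p-1}\log n-\log p$ converges weakly to the distribution on $\mathbb R$ with distribution function $F(y)=1-e^{-Ke^{y/2}}$, $y\in\mathbb R$, where $K=\frac{1}{2\sqrt{2\pi}}$; and $2p\log\sin\Theta_{\max}+\frac{4p}{p-1}\log n-\log p$ converges weakly to the same distribution. -/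

import Mathlib

open MeasureTheory ProbabilityTheory Filter Topology

noncomputable section

namespace RandomAngles

/-- The unit sphere `𝕊^{p-1}` of the Euclidean space `ℝ^p`. -/
abbrev Sphere (p : ℕ) : Type := Metric.sphere (0 : EuclideanSpace ℝ (Fin p)) 1

/-- The uniform distribution on `𝕊^{p-1}`: the surface measure, normalized to total mass one. -/
def uniformSphere (p : ℕ) : Measure (Sphere p) :=
  ((volume : Measure (EuclideanSpace ℝ (Fin p))).toSphere Set.univ)⁻¹ •
    (volume : Measure (EuclideanSpace ℝ (Fin p))).toSphere

/-- The pairs of indices `i < j` of `n` points. -/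
abbrev Pairs (n : ℕ) : Type := {q : Fin n × Fin n // q.1 < q.2}

/-- The angle `Θ_{ij} ∈ [0, π]` between the `i`-th and the `j`-th of `n` points. -/
def Θ {n p : ℕ} (x : Fin n → Sphere p) (q : Pairs n) : ℝ :=
  InnerProductGeometry.angle (x q.1.1 : EuclideanSpace ℝ (Fin p)) (x q.1.2)

/-- The smallest of the pairwise angles of `n ≥ 2` points. -/
def Θmin {n p : ℕ} (x : Fin n → Sphere p) : ℝ := ⨅ q : Pairs n, Θ x q

/-- The largest of the pairwise angles of `n ≥ 2` points. -/
def Θmax {n p : ℕ} (x : Fin n → Sphere p) : ℝ := ⨆ q : Pairs n, Θ x q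

/-- `Y n → c` in probability, where `Y n` is a random variable on its own probability space. -/
def ConvergesInProbability {Ω : ℕ → Type*} [∀ n, MeasurableSpace (Ω n)]
    (P : ∀ n, Measure (Ω n)) (Y : ∀ n, Ω n → ℝ) (c : ℝ) : Prop :=
  ∀ ε : ℝ, 0 < ε → Tendsto (fun n => P n {ω | ε ≤ |Y n ω - c|}) atTop (𝓝 0)

/-- `Y n` converges weakly to the probability distribution on `ℝ` with distribution function `F`
(in particular, `F` is the distribution function of a probability measure). -/
def ConvergesWeakly {Ω : ℕ → Type*} [∀ n, MeasurableSpace (Ω n)]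
    (P : ∀ n, Measure (Ω n)) [∀ n, IsProbabilityMeasure (P n)]
    (Y : ∀ n, Ω n → ℝ) (F : ℝ → ℝ) : Prop :=
  ∃ (ν : Measure ℝ) (_ : IsProbabilityMeasure ν),
    (∀ y, cdf ν y = F y) ∧ TendstoInDistribution Y atTop (id : ℝ → ℝ) P ν

/-- The distribution function `F(y) = 1 - exp(-K e^{y/2})` with `K = 1 / (2 √(2π))`. -/
def extremeCDF (y : ℝ) : ℝ :=
  1 - Real.exp (-(1 / (2 * √(2 * Real.pi))) * Real.exp (y / 2))

/-- The normalization `2 p log sin θ + (4p / (p - 1)) log n - log p` of an angle `θ`. -/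
def normalized (n p : ℕ) (θ : ℝ) : ℝ :=
  2 * (p : ℝ) * Real.log (Real.sin θ) + 4 * (p : ℝ) / ((p : ℝ) - 1) * Real.log n - Real.log p

end RandomAngles

end

/-! Fix a sign `σ = ±1` and call two points related when `σ` times their inner product is at least
`c = cos t`. All pairwise angles (for `σ = -1`, their supplements) exceed `t` exactly when no two
points are related. By rotation invariance every point is related to a set of the same measure `v`,
the probability of a spherical cap. Adding points one at a time, Bonferroni gives `q (k+1) = q k *
(1 - k v) + O(k² v²)` for the avoidance probability `q k` (`avoidProb_succ_bounds`). Hence `q n →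
exp (-L / 2)` when `n² v → L` (`tendsto_avoidProb_exp`), and `q n → 0` already when `n v → ∞`
(`tendsto_avoidProb_zero`). For (i), a cap of fixed chordal radius `ε` has probability at least
`(ε/4)^p`, and `n (ε/4)^p → ∞` because `log n / p → ∞`. For (ii), with `c = cos (arcsin s)` and `c →
1`, the cap probability is asymptotic to `s^(p-1) / √(2π p)` (`capProb_bounds`,
`tendsto_ballRatio_div_sqrt`). The normalization makes `n² s^(p-1) ~ √p e^(y/2)`, so `L / 2 = K
e^(y/2)`. The maximum reduces to the minimum for `σ = -1`, since `sin (π - θ) = sin θ`. -/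

noncomputable section

namespace RandomAngles

/-! ### Avoidance of a relation by independent points: recursion and bounds. -/

section Avoid

variable {S : Type*}

/-- The `k`-tuples of points no two of which are related by `R`. -/
def avoid (R : Set (S × S)) (k : ℕ) : Set (Fin k → S) :=
  {x | ∀ i j, i < j → (x i, x j) ∉ R}

/-- Bonferroni: if the new point `z.1` is related to `N` old ones, then `1 - N ≤ 1_{N = 0} ≤ 1 - N +
N (N - 1)`. The pair terms drop the avoidance condition, which only enlarges the upper bound and
leaves independent events. -/
theorem indicator_avoid_bounds {R : Set (S × S)} {k : ℕ} (z : S × (Fin k → S)) :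
    ({z : S × (Fin k → S) | z.2 ∈ avoid R k}.indicator (1 : S × (Fin k → S) → ℝ) z
      - ∑ i, {z : S × (Fin k → S) | z.2 ∈ avoid R k ∧ (z.2 i, z.1) ∈ R}.indicator (1 : S × (Fin k → S) → ℝ) z
      ≤ {z : S × (Fin k → S) | z.2 ∈ avoid R k ∧ ∀ i, (z.2 i, z.1) ∉ R}.indicator (1 : S × (Fin k → S) → ℝ) z) ∧
    ({z : S × (Fin k → S) | z.2 ∈ avoid R k ∧ ∀ i, (z.2 i, z.1) ∉ R}.indicator (1 : S × (Fin k → S) → ℝ) z ≤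
      {z : S × (Fin k → S) | z.2 ∈ avoid R k}.indicator (1 : S × (Fin k → S) → ℝ) z
      - ∑ i, {z : S × (Fin k → S) | z.2 ∈ avoid R k ∧ (z.2 i, z.1) ∈ R}.indicator (1 : S × (Fin k → S) → ℝ) z
      + ∑ i, ∑ j, {z : S × (Fin k → S) |
          i ≠ j ∧ (z.2 i, z.1) ∈ R ∧ (z.2 j, z.1) ∈ R}.indicator (1 : S × (Fin k → S) → ℝ) z) := by
  classical
  have hD : ∀ i j, 0 ≤ {z : S × (Fin k → S) |
      i ≠ j ∧ (z.2 i, z.1) ∈ R ∧ (z.2 j, z.1) ∈ R}.indicator (1 : S × (Fin k → S) → ℝ) z := fun i j =>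
    Set.indicator_nonneg (fun _ _ => zero_le_one) _
  by_cases hz : z.2 ∈ avoid R k
  · by_cases hb : ∀ i, (z.2 i, z.1) ∉ R
    · simp [Set.indicator, hz, hb]
    · push Not at hb
      obtain ⟨l, hl⟩ := hb
      have hn : ¬ ∀ i, (z.2 i, z.1) ∉ R := fun h => h l hl
      have h1 : (1 : ℝ) ≤ ∑ i, if (z.2 i, z.1) ∈ R then (1 : ℝ) else 0 := by
        have := Finset.single_le_sum (f := fun i => if (z.2 i, z.1) ∈ R then (1 : ℝ) else 0)
          (fun i _ => by positivity) (Finset.mem_univ l)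
        simpa [hl] using this
      -- Row `l` of the double sum alone contributes `N - 1`.
      have h2 : (∑ j, if (z.2 j, z.1) ∈ R then (1 : ℝ) else 0) - 1 ≤
          ∑ i, ∑ j, {z : S × (Fin k → S) |
            i ≠ j ∧ (z.2 i, z.1) ∈ R ∧ (z.2 j, z.1) ∈ R}.indicator (1 : S × (Fin k → S) → ℝ) z := by
        refine le_trans (le_of_eq ?_) (Finset.single_le_sum
          (fun i _ => Finset.sum_nonneg fun j _ => hD i j) (Finset.mem_univ l))
        have : (1 : ℝ) = ∑ j, if j = l then (1 : ℝ) else 0 := by simp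
        rw [this, ← Finset.sum_sub_distrib]
        refine Finset.sum_congr rfl fun j _ => ?_
        by_cases hj : j = l
        · subst hj; simp [Set.indicator, hl]
        · simp [Set.indicator, hl, hj, Ne.symm hj]
      simp only [Set.indicator, Set.mem_ofPred_eq, hz, hn, true_and, if_true, if_false,
        Pi.one_apply] at h2 ⊢
      constructor <;> linarith
  · have := Finset.sum_nonneg fun i (_ : i ∈ Finset.univ) =>
      Finset.sum_nonneg fun j (_ : j ∈ Finset.univ) => hD i j
    simpa [Set.indicator, hz] using this

variable [MeasurableSpace S]

theorem measurableSet_avoid {R : Set (S × S)} (hR : MeasurableSet R) (k : ℕ) :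
    MeasurableSet (avoid R k) := by
  have : avoid R k = ⋂ i, ⋂ j, ⋂ _ : i < j, ((fun x : Fin k → S => (x i, x j)) ⁻¹' R)ᶜ := by
    ext x; simp [avoid]
  rw [this]
  refine MeasurableSet.iInter fun i => MeasurableSet.iInter fun j => MeasurableSet.iInter fun _ => ?_
  exact (hR.preimage (by fun_prop)).compl

/-- The probability that no two of `k` independent points are related by `R`. -/
def avoidProb (μ : Measure S) (R : Set (S × S)) (k : ℕ) : ℝ :=
  (Measure.pi fun _ : Fin k => μ).real (avoid R k)

variable (μ : Measure S) {R : Set (S × S)}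

theorem avoidProb_nonneg (k : ℕ) : 0 ≤ avoidProb μ R k := measureReal_nonneg

variable [IsProbabilityMeasure μ]

theorem avoidProb_zero : avoidProb μ R 0 = 1 := by
  have : avoid R 0 = Set.univ := by ext x; simp [avoid]
  simp [avoidProb, this]

theorem avoidProb_one : avoidProb μ R 1 = 1 := by
  have : avoid R 1 = Set.univ := by
    ext x
    simp only [avoid, Set.mem_ofPred_eq, Set.mem_univ, iff_true]
    intro i j h
    omega
  simp [avoidProb, this]

/-- The last coordinate is the one split off: its index exceeds all others, so it is always the
second entry of a pair and `R` need not be symmetric. -/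
theorem avoidProb_succ_eq (hR : MeasurableSet R) (k : ℕ) :
    avoidProb μ R (k + 1) = (μ.prod (Measure.pi fun _ : Fin k => μ)).real
      {z | z.2 ∈ avoid R k ∧ ∀ i, (z.2 i, z.1) ∉ R} := by
  have h := measurePreserving_piFinSuccAbove (fun _ : Fin (k + 1) => μ) (Fin.last k)
  have hA : MeasurableSet {z : S × (Fin k → S) | z.2 ∈ avoid R k ∧ ∀ i, (z.2 i, z.1) ∉ R} := by
    have : {z : S × (Fin k → S) | z.2 ∈ avoid R k ∧ ∀ i, (z.2 i, z.1) ∉ R} =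
        (Prod.snd ⁻¹' avoid R k) ∩
          ⋂ i, ((fun z : S × (Fin k → S) => (z.2 i, z.1)) ⁻¹' R)ᶜ := by
      ext z; simp
    rw [this]
    exact (measurable_snd (measurableSet_avoid hR k)).inter
      (MeasurableSet.iInter fun i => (hR.preimage (by fun_prop)).compl)
  rw [avoidProb, measureReal_def, measureReal_def, ← h.measure_preimage hA.nullMeasurableSet]
  congr 2
  ext x
  simp only [avoid, Set.mem_ofPred_eq, Set.mem_preimage, MeasurableEquiv.piFinSuccAbove_apply,
    Fin.insertNthEquiv, Equiv.coe_fn_symm_mk, Fin.removeNth, Fin.succAbove_last]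
  constructor
  · intro hx
    exact ⟨fun i j hij => hx _ _ (by simpa using hij), fun i => hx _ _ (Fin.castSucc_lt_last i)⟩
  · rintro ⟨h1, h2⟩ i j hij
    induction j using Fin.lastCases with
    | last =>
      induction i using Fin.lastCases with
      | last => exact absurd hij (lt_irrefl _)
      | cast i => exact h2 i
    | cast j =>
      induction i using Fin.lastCases with
      | last => exact absurd (hij.trans (Fin.castSucc_lt_last j)) (lt_irrefl _)
      | cast i => exact h1 i j (by simpa using hij)

variable {v : ℝ}

theorem real_avoid_and_rel (hR : MeasurableSet R)
    (hv : ∀ x, μ.real {y | (x, y) ∈ R} = v) {k : ℕ} (i : Fin k) :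
    (μ.prod (Measure.pi fun _ : Fin k => μ)).real
      {z | z.2 ∈ avoid R k ∧ (z.2 i, z.1) ∈ R} = avoidProb μ R k * v := by
  have hm : MeasurableSet {z : S × (Fin k → S) | z.2 ∈ avoid R k ∧ (z.2 i, z.1) ∈ R} :=
    (measurable_snd (measurableSet_avoid hR k)).inter
      (hR.preimage (f := fun z : S × (Fin k → S) => (z.2 i, z.1)) (by fun_prop))
  have hv' : ∀ x, μ {y | (x, y) ∈ R} = ENNReal.ofReal v := fun x => by
    rw [← hv x, ofReal_measureReal]
  have key : ∀ x : Fin k → S, μ ((fun y => (y, x)) ⁻¹'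
      {z : S × (Fin k → S) | z.2 ∈ avoid R k ∧ (z.2 i, z.1) ∈ R}) =
      (avoid R k).indicator (fun _ => ENNReal.ofReal v) x := by
    intro x
    by_cases hx : x ∈ avoid R k <;> simp [hx, hv']
  rw [measureReal_def, Measure.prod_apply_symm hm]
  simp_rw [key]
  rw [lintegral_indicator (measurableSet_avoid hR k), setLIntegral_const, ENNReal.toReal_mul,
    mul_comm, avoidProb, measureReal_def, ← hv' , ← hv, measureReal_def]
  exact (Measure.pi fun _ : Fin k => μ).nonempty_of_neZero.some i

/-- With the new point fixed, the conditions on two distinct coordinates are independent, each of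
probability `v`. Diagonal terms vanish, hence the inequality. -/
theorem real_rel_and_rel_le (hR : MeasurableSet R)
    (hv : ∀ y, μ.real {x | (x, y) ∈ R} = v) {k : ℕ} (i j : Fin k) :
    (μ.prod (Measure.pi fun _ : Fin k => μ)).real
      {z | i ≠ j ∧ (z.2 i, z.1) ∈ R ∧ (z.2 j, z.1) ∈ R} ≤ v ^ 2 := by
  by_cases hij : i = j
  · simp [hij]; positivity
  have hm : MeasurableSet {z : S × (Fin k → S) | (z.2 i, z.1) ∈ R ∧ (z.2 j, z.1) ∈ R} :=
    (hR.preimage (f := fun z : S × (Fin k → S) => (z.2 i, z.1)) (by fun_prop)).inter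
      (hR.preimage (f := fun z : S × (Fin k → S) => (z.2 j, z.1)) (by fun_prop))
  have hv' : ∀ y, μ {x | (x, y) ∈ R} = ENNReal.ofReal v := fun x => by
    rw [← hv x, ofReal_measureReal]
  have key : ∀ y : S, (Measure.pi fun _ : Fin k => μ) (Prod.mk y ⁻¹'
      {z : S × (Fin k → S) | (z.2 i, z.1) ∈ R ∧ (z.2 j, z.1) ∈ R}) = ENNReal.ofReal v ^ 2 := by
    intro y
    have : Prod.mk y ⁻¹' {z : S × (Fin k → S) | (z.2 i, z.1) ∈ R ∧ (z.2 j, z.1) ∈ R} =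
        Set.univ.pi fun l => if l ∈ ({i, j} : Finset (Fin k)) then {x | (x, y) ∈ R}
          else Set.univ := by
      ext x
      simp only [Set.mem_preimage, Set.mem_ofPred_eq, Set.mem_pi, Set.mem_univ, true_implies]
      constructor
      · rintro ⟨h1, h2⟩ l
        split_ifs with hl
        · simp only [Finset.mem_insert, Finset.mem_singleton] at hl
          rcases hl with rfl | rfl
          exacts [h1, h2]
        · trivial
      · intro h
        exact ⟨by simpa using h i, by simpa using h j⟩
    rw [this, Measure.pi_pi]
    have : ∀ l, μ (if l ∈ ({i, j} : Finset (Fin k)) then {x | (x, y) ∈ R} else Set.univ) =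
        if l ∈ ({i, j} : Finset (Fin k)) then ENNReal.ofReal v else 1 := by
      intro l; split_ifs <;> simp [hv']
    simp_rw [this]
    rw [Finset.prod_ite_mem, Finset.univ_inter, Finset.prod_const, Finset.card_pair hij]
  simp only [ne_eq, hij, not_false_eq_true, true_and]
  rw [measureReal_def, Measure.prod_apply hm]
  simp_rw [key]
  obtain ⟨y⟩ := μ.nonempty_of_neZero
  simp [← hv y, measureReal_def]

theorem avoidProb_succ_bounds (hR : MeasurableSet R)
    (hv : ∀ x, μ.real {y | (x, y) ∈ R} = v) (hv' : ∀ y, μ.real {x | (x, y) ∈ R} = v) (k : ℕ) :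
    avoidProb μ R k * (1 - k * v) ≤ avoidProb μ R (k + 1) ∧
    avoidProb μ R (k + 1) ≤ avoidProb μ R k * (1 - k * v) + k ^ 2 * v ^ 2 := by
  set ν := μ.prod (Measure.pi fun _ : Fin k => μ) with hν
  have mR : ∀ i, MeasurableSet {z : S × (Fin k → S) | (z.2 i, z.1) ∈ R} := fun i =>
    hR.preimage (f := fun z : S × (Fin k → S) => (z.2 i, z.1)) (by fun_prop)
  have mE : MeasurableSet {z : S × (Fin k → S) | z.2 ∈ avoid R k} :=
    measurable_snd (measurableSet_avoid hR k)
  have mF : ∀ i, MeasurableSet {z : S × (Fin k → S) | z.2 ∈ avoid R k ∧ (z.2 i, z.1) ∈ R} :=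
    fun i => mE.inter (mR i)
  have mD : ∀ i j, MeasurableSet {z : S × (Fin k → S) |
      i ≠ j ∧ (z.2 i, z.1) ∈ R ∧ (z.2 j, z.1) ∈ R} := fun i j =>
    (MeasurableSet.const _).inter ((mR i).inter (mR j))
  have mA : MeasurableSet {z : S × (Fin k → S) | z.2 ∈ avoid R k ∧ ∀ i, (z.2 i, z.1) ∉ R} := by
    have : {z : S × (Fin k → S) | z.2 ∈ avoid R k ∧ ∀ i, (z.2 i, z.1) ∉ R} =
        {z : S × (Fin k → S) | z.2 ∈ avoid R k} ∩
          ⋂ i, {z : S × (Fin k → S) | (z.2 i, z.1) ∈ R}ᶜ := by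
      ext z; simp
    rw [this]
    exact mE.inter (MeasurableSet.iInter fun i => (mR i).compl)
  have hI : ∀ {A : Set (S × (Fin k → S))}, MeasurableSet A →
      Integrable (A.indicator (1 : S × (Fin k → S) → ℝ)) ν := fun hA => (integrable_const (1 : ℝ)).indicator hA
  have hE : ν.real {z : S × (Fin k → S) | z.2 ∈ avoid R k} = avoidProb μ R k := by
    rw [show {z : S × (Fin k → S) | z.2 ∈ avoid R k} = Set.univ ×ˢ avoid R k by ext; simp,
      hν, measureReal_prod_prod]
    simp [avoidProb]
  have iF : Integrable (fun z => ∑ i, {z : S × (Fin k → S) |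
      z.2 ∈ avoid R k ∧ (z.2 i, z.1) ∈ R}.indicator (1 : S × (Fin k → S) → ℝ) z) ν :=
    integrable_finsetSum _ fun i _ => hI (mF i)
  have iD : Integrable (fun z => ∑ i, ∑ j, {z : S × (Fin k → S) |
      i ≠ j ∧ (z.2 i, z.1) ∈ R ∧ (z.2 j, z.1) ∈ R}.indicator (1 : S × (Fin k → S) → ℝ) z) ν :=
    integrable_finsetSum _ fun i _ => integrable_finsetSum _ fun j _ => hI (mD i j)
  have sF : ∫ z, ∑ i, {z : S × (Fin k → S) |
      z.2 ∈ avoid R k ∧ (z.2 i, z.1) ∈ R}.indicator (1 : S × (Fin k → S) → ℝ) z ∂ν =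
      k * (avoidProb μ R k * v) := by
    rw [integral_finsetSum _ fun i _ => hI (mF i)]
    simp_rw [integral_indicator_one (mF _), hν, real_avoid_and_rel μ hR hv]
    simp
  have sD : ∫ z, ∑ i, ∑ j, {z : S × (Fin k → S) |
      i ≠ j ∧ (z.2 i, z.1) ∈ R ∧ (z.2 j, z.1) ∈ R}.indicator (1 : S × (Fin k → S) → ℝ) z ∂ν ≤
      k ^ 2 * v ^ 2 := by
    rw [integral_finsetSum _ fun i _ => integrable_finsetSum _ fun j _ => hI (mD i j)]
    simp_rw [integral_finsetSum _ fun j _ => hI (mD _ j), integral_indicator_one (mD _ _)]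
    refine (Finset.sum_le_sum fun i _ => Finset.sum_le_sum fun j _ =>
      real_rel_and_rel_le μ hR hv' i j).trans (le_of_eq ?_)
    simp; ring
  rw [avoidProb_succ_eq μ hR, ← integral_indicator_one mA, ← hν]
  constructor
  · calc avoidProb μ R k * (1 - k * v) = avoidProb μ R k - k * (avoidProb μ R k * v) := by ring
      _ = _ := by rw [← sF, ← hE, ← integral_indicator_one mE, ← integral_sub (hI mE) iF]; rfl
      _ ≤ _ := integral_mono ((hI mE).sub iF) (hI mA) fun z => (indicator_avoid_bounds z).1
  · calc _ ≤ _ := integral_mono (hI mA) (((hI mE).sub iF).add iD)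
          fun z => (indicator_avoid_bounds z).2
      _ = avoidProb μ R k - k * (avoidProb μ R k * v) + _ := by
        rw [integral_add' ((hI mE).sub iF) iD, integral_sub' (hI mE) iF, sF,
          integral_indicator_one mE, hE]
      _ ≤ _ := by linarith

/-- Only the condition that the new point is unrelated to point `0` is kept. This is crude but has
no error term, so it serves when `n v` is large. -/
theorem avoidProb_succ_succ_le (hR : MeasurableSet R)
    (hv : ∀ x, μ.real {y | (x, y) ∈ R} = v) (k : ℕ) :
    avoidProb μ R (k + 2) ≤ avoidProb μ R (k + 1) * (1 - v) := by
  set ν := μ.prod (Measure.pi fun _ : Fin (k + 1) => μ) with hν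
  have mE : MeasurableSet {z : S × (Fin (k + 1) → S) | z.2 ∈ avoid R (k + 1)} :=
    measurable_snd (measurableSet_avoid hR _)
  have mF : MeasurableSet {z : S × (Fin (k + 1) → S) |
      z.2 ∈ avoid R (k + 1) ∧ (z.2 0, z.1) ∈ R} := mE.inter
    (hR.preimage (f := fun z : S × (Fin (k + 1) → S) => (z.2 0, z.1)) (by fun_prop))
  have hE : ν.real {z : S × (Fin (k + 1) → S) | z.2 ∈ avoid R (k + 1)} =
      avoidProb μ R (k + 1) := by
    rw [show {z : S × (Fin (k + 1) → S) | z.2 ∈ avoid R (k + 1)} =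
      Set.univ ×ˢ avoid R (k + 1) by ext; simp, hν, measureReal_prod_prod]
    simp [avoidProb]
  have hF := real_avoid_and_rel μ hR hv (0 : Fin (k + 1))
  rw [mul_sub, mul_one, ← hF, ← hE, avoidProb_succ_eq μ hR, ← hν, ← measureReal_sdiff _ mF]
  · exact measureReal_mono fun z hz => ⟨hz.1, fun h => hz.2 0 h.2⟩
  · exact fun z hz => hz.1

theorem avoidProb_le_exp (hR : MeasurableSet R)
    (hv : ∀ x, μ.real {y | (x, y) ∈ R} = v) (k : ℕ) :
    avoidProb μ R (k + 1) ≤ Real.exp (-(k * v)) := by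
  induction k with
  | zero => simp [avoidProb_one]
  | succ k ih =>
    have h1 : v ≤ 1 := by
      obtain ⟨x⟩ := μ.nonempty_of_neZero
      exact hv x ▸ measureReal_le_one
    calc _ ≤ avoidProb μ R (k + 1) * (1 - v) := avoidProb_succ_succ_le μ hR hv k
      _ ≤ Real.exp (-(k * v)) * Real.exp (-v) := by
        gcongr
        exact Real.one_sub_le_exp_neg v
      _ = _ := by rw [← Real.exp_add]; push_cast; ring_nf

/-- Iterating the upper recursion, the main factors give `exp (-∑ j v)` and the errors `j² v²` add
up to at most `k³ v²`; `k v ≤ 1` keeps the factors nonnegative. -/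
theorem avoidProb_le (hR : MeasurableSet R)
    (hv : ∀ x, μ.real {y | (x, y) ∈ R} = v) (hv' : ∀ y, μ.real {x | (x, y) ∈ R} = v) {k : ℕ}
    (hk : k * v ≤ 1) :
    avoidProb μ R k ≤ Real.exp (-(k * (k - 1) / 2 * v)) + k ^ 3 * v ^ 2 := by
  have hv0 : 0 ≤ v := by
    obtain ⟨x⟩ := μ.nonempty_of_neZero
    exact hv x ▸ measureReal_nonneg
  induction k with
  | zero => simp [avoidProb_zero]
  | succ k ih =>
    push_cast at hk ⊢
    have hk' : k * v ≤ 1 := by nlinarith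
    have h0 : 0 ≤ 1 - k * v := by linarith
    calc _ ≤ _ := (avoidProb_succ_bounds μ hR hv hv' k).2
      _ ≤ (Real.exp (-(k * (k - 1) / 2 * v)) + k ^ 3 * v ^ 2) * (1 - k * v) + k ^ 2 * v ^ 2 := by
        gcongr; exact ih hk'
      _ ≤ Real.exp (-(k * (k - 1) / 2 * v)) * Real.exp (-(k * v)) + k ^ 3 * v ^ 2 * 1
          + k ^ 2 * v ^ 2 := by
        rw [add_mul]
        gcongr
        · exact Real.one_sub_le_exp_neg _
        · have : 0 ≤ k * v := by positivity
          linarith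
      _ ≤ _ := by
        rw [← Real.exp_add]
        -- The slack `(k+1)³ - k³ - k²`.
        have : 0 ≤ v ^ 2 * (2 * k ^ 2 + 3 * k + 1) := by positivity
        have e : -(k * ((k : ℝ) - 1) / 2 * v) + -(k * v) = -((k + 1) * (k + 1 - 1) / 2 * v) := by
          ring
        rw [e]
        nlinarith

/-- Uses `1 - x ≥ exp (-x / (1 - x))` at `x = k v`, with the denominator lowered to `1 - n v` so
that one rate serves every `k ≤ n`. -/
theorem le_avoidProb (hR : MeasurableSet R)
    (hv : ∀ x, μ.real {y | (x, y) ∈ R} = v) (hv' : ∀ y, μ.real {x | (x, y) ∈ R} = v) {n k : ℕ}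
    (hn : n * v < 1) (hk : k ≤ n) :
    Real.exp (-(k * (k - 1) / 2 * (v / (1 - n * v)))) ≤ avoidProb μ R k := by
  have hv0 : 0 ≤ v := by
    obtain ⟨x⟩ := μ.nonempty_of_neZero
    exact hv x ▸ measureReal_nonneg
  induction k with
  | zero => simp [avoidProb_zero]
  | succ k ih =>
    have hkn : (k : ℝ) * v ≤ n * v := by
      have : (k : ℝ) ≤ n := by exact_mod_cast (Nat.le_succ k).trans hk
      gcongr
    have h1 : 0 < 1 - k * v := by linarith
    have h2 : 0 < 1 - n * v := by linarith
    have h3 : Real.exp (-(k * (v / (1 - n * v)))) ≤ 1 - k * v := by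
      have h4 : (1 - k * v)⁻¹ ≤ Real.exp (k * (v / (1 - n * v))) := by
        have h5 : (1 - k * v)⁻¹ ≤ k * (v / (1 - n * v)) + 1 := by
          have : (1 - k * v)⁻¹ = k * (v / (1 - k * v)) + 1 := by field_simp; ring
          rw [this]
          gcongr
        exact h5.trans (Real.add_one_le_exp _)
      rw [Real.exp_neg]
      exact inv_le_of_inv_le₀ h1 h4
    refine le_trans ?_ (avoidProb_succ_bounds μ hR hv hv' k).1
    calc
      _ = Real.exp (-(k * (k - 1) / 2 * (v / (1 - n * v)))) *
          Real.exp (-(k * (v / (1 - n * v)))) := by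
        rw [← Real.exp_add]; push_cast; ring_nf
      _ ≤ _ := mul_le_mul (ih ((Nat.le_succ k).trans hk)) h3 (Real.exp_pos _).le
        (avoidProb_nonneg _ _)

end Avoid

/-! ### Limits of the avoidance probability. -/

section AvoidLimit

variable {S : ℕ → Type*} [∀ n, MeasurableSpace (S n)] (μ : ∀ n, Measure (S n))
  {R : ∀ n, Set (S n × S n)} {v : ℕ → ℝ}

theorem tendsto_avoidProb_zero (hμ : ∀ᶠ n in atTop, IsProbabilityMeasure (μ n))
    (hR : ∀ n, MeasurableSet (R n))
    (hv : ∀ᶠ n in atTop, ∀ x, (μ n).real {y | (x, y) ∈ R n} = v n)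
    (hlim : Tendsto (fun n : ℕ => n * v n) atTop atTop) :
    Tendsto (fun n => avoidProb (μ n) (R n) n) atTop (𝓝 0) := by
  have h1 : Tendsto (fun n : ℕ => Real.exp (-(n * v n - 1))) atTop (𝓝 0) :=
    Real.tendsto_exp_neg_atTop_nhds_zero.comp (tendsto_atTop_add_const_right _ (-1) hlim)
  refine tendsto_of_tendsto_of_tendsto_of_le_of_le' tendsto_const_nhds h1
    (Eventually.of_forall fun n => measureReal_nonneg) ?_
  filter_upwards [hμ, hv, eventually_ge_atTop 1] with n hμn hvn hn
  obtain ⟨k, rfl⟩ := Nat.exists_eq_add_of_le' hn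
  refine (avoidProb_le_exp _ (hR _) hvn k).trans (Real.exp_le_exp.2 ?_)
  obtain ⟨x⟩ := (μ (k + 1)).nonempty_of_neZero
  have h1 : v (k + 1) ≤ 1 := hvn x ▸ measureReal_le_one
  push_cast
  linarith

theorem tendsto_avoidProb_exp (hμ : ∀ᶠ n in atTop, IsProbabilityMeasure (μ n))
    (hR : ∀ n, MeasurableSet (R n))
    (hv : ∀ᶠ n in atTop, ∀ x, (μ n).real {y | (x, y) ∈ R n} = v n)
    (hv' : ∀ᶠ n in atTop, ∀ y, (μ n).real {x | (x, y) ∈ R n} = v n)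
    {L : ℝ} (hlim : Tendsto (fun n : ℕ => (n : ℝ) ^ 2 * v n) atTop (𝓝 L)) :
    Tendsto (fun n => avoidProb (μ n) (R n) n) atTop (𝓝 (Real.exp (-(L / 2)))) := by
  have hinv : Tendsto (fun n : ℕ => ((n : ℝ))⁻¹) atTop (𝓝 0) := tendsto_inv_atTop_nhds_zero_nat
  have h1 : Tendsto (fun n : ℕ => (n : ℝ) * v n) atTop (𝓝 0) := by
    have := hlim.mul hinv
    rw [mul_zero] at this
    refine this.congr' ?_
    filter_upwards [eventually_ge_atTop 1] with n hn
    field_simp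
  have h2 : Tendsto (fun n : ℕ => (n : ℝ) ^ 3 * v n ^ 2) atTop (𝓝 0) := by
    have := (hlim.mul hlim).mul hinv
    rw [mul_zero] at this
    refine this.congr' ?_
    filter_upwards [eventually_ge_atTop 1] with n hn
    field_simp
  have h3 : Tendsto (fun n : ℕ => (n : ℝ) * (n - 1) / 2 * v n) atTop (𝓝 (L / 2)) := by
    have := (hlim.sub h1).div_const 2
    rw [sub_zero] at this
    refine this.congr fun n => ?_
    ring
  have h4 : Tendsto (fun n : ℕ => (n : ℝ) * (n - 1) / 2 * (v n / (1 - n * v n))) atTop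
      (𝓝 (L / 2)) := by
    have := h3.div (tendsto_const_nhds (x := (1 : ℝ)).sub h1) (by norm_num)
    rw [sub_zero, div_one] at this
    refine this.congr fun n => ?_
    simp only [Pi.div_apply]
    ring
  have h5 := ((Real.continuous_exp.tendsto _).comp h3.neg).add h2
  rw [add_zero] at h5
  refine tendsto_of_tendsto_of_tendsto_of_le_of_le'
    ((Real.continuous_exp.tendsto _).comp h4.neg) h5 ?_ ?_
  · filter_upwards [hμ, hv, hv', h1.eventually_lt_const one_pos] with n hμn hvn hvn' hn
    exact le_avoidProb _ (hR n) hvn hvn' hn le_rfl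
  · filter_upwards [hμ, hv, hv', h1.eventually_lt_const one_pos] with n hμn hvn hvn' hn
    exact avoidProb_le _ (hR n) hvn hvn' hn.le

end AvoidLimit

/-! ### Spherical caps as volumes of sectors. -/

open scoped Pointwise

/-- The points of the punctured unit ball whose direction has inner product at least `c`
with `u`. -/
def sector {p : ℕ} (u : EuclideanSpace ℝ (Fin p)) (c : ℝ) : Set (EuclideanSpace ℝ (Fin p)) :=
  {z | ‖z‖ < 1 ∧ z ≠ 0 ∧ c * ‖z‖ ≤ inner ℝ u z}

theorem measurableSet_cap {p : ℕ} (u : EuclideanSpace ℝ (Fin p)) (c : ℝ) :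
    MeasurableSet {y : Sphere p | c ≤ inner ℝ u (y : EuclideanSpace ℝ (Fin p))} :=
  measurableSet_le measurable_const (by fun_prop)

/-- `toSphere` measures a set through the cone over it with radii in `(0, 1)`; this identifies that
cone. -/
theorem Ioo_smul_cap {p : ℕ} (u : EuclideanSpace ℝ (Fin p)) (c : ℝ) :
    Set.Ioo (0 : ℝ) 1 • ((↑) '' {y : Sphere p | c ≤ inner ℝ u (y : EuclideanSpace ℝ (Fin p))}) =
      sector u c := by
  ext z
  simp only [Set.mem_smul, Set.mem_image, sector, Set.mem_ofPred_eq]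
  constructor
  · rintro ⟨r, hr, _, ⟨y, hy, rfl⟩, rfl⟩
    have hy1 : ‖(y : EuclideanSpace ℝ (Fin p))‖ = 1 := by simp
    have hn : ‖r • (y : EuclideanSpace ℝ (Fin p))‖ = r := by
      rw [norm_smul, hy1, mul_one, Real.norm_of_nonneg hr.1.le]
    refine ⟨by rw [hn]; exact hr.2, ?_, ?_⟩
    · rw [← norm_ne_zero_iff, hn]; exact hr.1.ne'
    · rw [hn, inner_smul_right, mul_comm]
      exact mul_le_mul_of_nonneg_left hy hr.1.le
  · rintro ⟨h1, h2, h3⟩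
    have hpos : 0 < ‖z‖ := norm_pos_iff.2 h2
    refine ⟨‖z‖, ⟨hpos, h1⟩, ‖z‖⁻¹ • z, ⟨⟨‖z‖⁻¹ • z, ?_⟩, ?_, rfl⟩, ?_⟩
    · simp [norm_smul, hpos.ne']
    · simp only [inner_smul_right]
      rw [inv_mul_eq_div, le_div_iff₀ hpos]
      exact h3
    · rw [smul_smul, mul_inv_cancel₀ hpos.ne', one_smul]

theorem isProbabilityMeasure_uniformSphere {p : ℕ} (hp : 1 ≤ p) :
    IsProbabilityMeasure (uniformSphere p) := by
  have : Nontrivial (EuclideanSpace ℝ (Fin p)) := by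
    have : Nonempty (Fin p) := ⟨⟨0, hp⟩⟩
    infer_instance
  constructor
  rw [uniformSphere, Measure.smul_apply, smul_eq_mul]
  refine ENNReal.inv_mul_cancel ?_ (measure_ne_top _ _)
  rw [Measure.measure_univ_ne_zero]
  exact Measure.toSphere_ne_zero _

theorem uniformSphere_real_cap {p : ℕ} (hp : 1 ≤ p) (u : EuclideanSpace ℝ (Fin p)) (c : ℝ) :
    (uniformSphere p).real {y : Sphere p | c ≤ inner ℝ u (y : EuclideanSpace ℝ (Fin p))} =
      volume.real (sector u c) /
        volume.real (Metric.ball (0 : EuclideanSpace ℝ (Fin p)) 1) := by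
  have hp' : (p : ℝ) ≠ 0 := by positivity
  rw [uniformSphere, measureReal_def, Measure.smul_apply, smul_eq_mul,
    Measure.toSphere_apply' _ (measurableSet_cap u c), Ioo_smul_cap,
    Measure.toSphere_apply_univ]
  simp only [ENNReal.toReal_mul, ENNReal.toReal_inv, finrank_euclideanSpace, Fintype.card_fin,
    ENNReal.toReal_natCast, measureReal_def]
  field_simp

/-- The reflection in the hyperplane orthogonal to `u - u'` takes `u` to `u'` and preserves volume.
-/
theorem volume_sector_eq {p : ℕ} {u u' : EuclideanSpace ℝ (Fin p)} (h : ‖u‖ = ‖u'‖) (c : ℝ) :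
    volume (sector u c) = volume (sector u' c) := by
  set T := Submodule.reflection (ℝ ∙ (u - u'))ᗮ with hT
  have hTu : T u = u' := Submodule.reflection_sub h
  have hpre : T ⁻¹' sector u' c = sector u c := by
    ext z
    simp only [sector, Set.mem_preimage, Set.mem_ofPred_eq, LinearIsometryEquiv.norm_map, ne_eq,
      EmbeddingLike.map_eq_zero_iff, ← hTu, LinearIsometryEquiv.inner_map_map]
  rw [← hpre]
  exact T.measurePreserving.measure_preimage_emb
    T.toHomeomorph.measurableEmbedding _

/-- As `‖u - y‖² = 2 - 2⟪u, y⟫`, the cap contains the ball of chordal radius `ε`, to which the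
general lower bound `toSphereBallBound` applies. -/
theorem pow_le_uniformSphere_real_cap {p : ℕ} (hp : 1 ≤ p) {u : EuclideanSpace ℝ (Fin p)}
    (hu : ‖u‖ = 1) {ε : ℝ} (hε : 0 < ε) (hε2 : ε ≤ 2) :
    (ε / 4) ^ p ≤ (uniformSphere p).real
      {y : Sphere p | 1 - ε ^ 2 / 2 ≤ inner ℝ u (y : EuclideanSpace ℝ (Fin p))} := by
  have := isProbabilityMeasure_uniformSphere hp
  have hnt : Nontrivial (EuclideanSpace ℝ (Fin p)) := by
    have : Nonempty (Fin p) := ⟨⟨0, hp⟩⟩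
    infer_instance
  set x : Sphere p := ⟨u, by simpa using hu⟩
  have hsub : Metric.ball x ε ⊆
      {y : Sphere p | 1 - ε ^ 2 / 2 ≤ inner ℝ u (y : EuclideanSpace ℝ (Fin p))} := by
    intro y hy
    rw [Metric.mem_ball, dist_comm, Subtype.dist_eq, dist_eq_norm] at hy
    have hy1 : ‖(y : EuclideanSpace ℝ (Fin p))‖ = 1 := by simp
    have h1 := norm_sub_sq_real u (y : EuclideanSpace ℝ (Fin p))
    rw [hu, hy1] at h1
    have h2 : ‖u - (y : EuclideanSpace ℝ (Fin p))‖ ^ 2 < ε ^ 2 := by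
      gcongr
    simp only [Set.mem_ofPred_eq]
    linarith
  refine le_trans ?_ (measureReal_mono hsub)
  have hb := Measure.toSphereBallBound_mul_measureReal_unitBall_le_toSphere_ball
    (volume : Measure (EuclideanSpace ℝ (Fin p))) hε x
  have hpos : 0 < (volume : Measure (EuclideanSpace ℝ (Fin p))).real (Metric.ball 0 1) :=
    ENNReal.toReal_pos (Metric.measure_ball_pos _ _ one_pos).ne' measure_ball_lt_top.ne
  have hbound : (Measure.toSphereBallBound p ε : ℝ) = p * (ε / 4) ^ p := by
    have : min ε.toNNReal 2 = ε.toNNReal := min_eq_left (by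
      rw [← NNReal.coe_le_coe, Real.coe_toNNReal _ hε.le]; simpa using hε2)
    rw [Measure.toSphereBallBound, if_pos ⟨by omega, hε⟩, this]
    simp [hε.le]
  rw [finrank_euclideanSpace, Fintype.card_fin, hbound] at hb
  have hp' : (0 : ℝ) < p := by positivity
  have : (uniformSphere p).real (Metric.ball x ε) =
      (p * volume.real (Metric.ball (0 : EuclideanSpace ℝ (Fin p)) 1))⁻¹ *
        (volume : Measure (EuclideanSpace ℝ (Fin p))).toSphere.real (Metric.ball x ε) := by
    rw [uniformSphere, measureReal_def, Measure.smul_apply, smul_eq_mul, ENNReal.toReal_mul,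
      ENNReal.toReal_inv, ← measureReal_def, ← measureReal_def,
      Measure.toSphere_real_apply_univ, finrank_euclideanSpace, Fintype.card_fin]
  rw [this, inv_mul_eq_div, le_div_iff₀ (by positivity)]
  linarith

/-! ### Sector volumes by slicing along the first coordinate. -/

section Slices

variable {m : ℕ}

/-- The coordinates of a vector after the first one. -/
def tail (z : EuclideanSpace ℝ (Fin (m + 1))) : EuclideanSpace ℝ (Fin m) :=
  WithLp.toLp 2 fun i => z i.succ

theorem norm_sq_eq_tail (z : EuclideanSpace ℝ (Fin (m + 1))) :
    ‖z‖ ^ 2 = z 0 ^ 2 + ‖tail z‖ ^ 2 := by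
  simp [EuclideanSpace.norm_sq_eq, Fin.sum_univ_succ, tail]

theorem measurePreserving_head_tail :
    MeasurePreserving (fun z : EuclideanSpace ℝ (Fin (m + 1)) => (z 0, tail z)) volume
      ((volume : Measure ℝ).prod volume) := by
  have h1 := PiLp.volume_preserving_ofLp (Fin (m + 1))
  have h2 := volume_preserving_piFinSuccAbove (fun _ : Fin (m + 1) => ℝ) 0
  have h3 := (MeasurePreserving.id (volume : Measure ℝ)).prod (PiLp.volume_preserving_toLp (Fin m))
  have h := h3.comp (h2.comp h1)
  convert! h using 1

/-- Fubini over balls of radius `f t`. `I` is fixed only up to a null set, to allow both `Ioc` and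
`Ioo`. -/
theorem volume_slices {I : Set ℝ} {a b : ℝ} (hab : a ≤ b) (hI : MeasurableSet I)
    (hIab : I =ᵐ[volume] Set.Ioc a b) {f : ℝ → ℝ} (hf : Continuous f)
    (hf0 : ∀ t ∈ Set.Ioc a b, 0 ≤ f t) :
    volume.real {z : EuclideanSpace ℝ (Fin (m + 1)) | z 0 ∈ I ∧ ‖tail z‖ ≤ f (z 0)} =
      (∫ t in a..b, f t ^ m) * volume.real (Metric.ball (0 : EuclideanSpace ℝ (Fin m)) 1) := by
  set T : Set (ℝ × EuclideanSpace ℝ (Fin m)) := {w | w.1 ∈ I ∧ ‖w.2‖ ≤ f w.1}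
  have hT : MeasurableSet T :=
    (measurable_fst hI).inter (measurableSet_le
      (f := fun w : ℝ × EuclideanSpace ℝ (Fin m) => ‖w.2‖) (g := fun w => f w.1)
      (by fun_prop) (by fun_prop))
  have hpre : {z : EuclideanSpace ℝ (Fin (m + 1)) | z 0 ∈ I ∧ ‖tail z‖ ≤ f (z 0)} =
      (fun z : EuclideanSpace ℝ (Fin (m + 1)) => (z 0, tail z)) ⁻¹' T := rfl
  have hslice : ∀ t, (volume : Measure (EuclideanSpace ℝ (Fin m))) (Prod.mk t ⁻¹' T) =
      I.indicator (fun t => volume (Metric.closedBall (0 : EuclideanSpace ℝ (Fin m)) (f t))) t := by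
    intro t
    by_cases ht : t ∈ I
    · rw [Set.indicator_of_mem ht]
      congr 1
      ext w
      simp [T, ht]
    · simp [T, ht]
  have hint : ∫⁻ t in Set.Ioc a b, volume (Metric.closedBall (0 : EuclideanSpace ℝ (Fin m)) (f t)) =
      ∫⁻ t in Set.Ioc a b, ENNReal.ofReal (f t ^ m) *
        volume (Metric.ball (0 : EuclideanSpace ℝ (Fin m)) 1) := by
    refine setLIntegral_congr_fun measurableSet_Ioc fun t ht => ?_
    simp only [Measure.addHaar_closedBall _ _ (hf0 t ht), finrank_euclideanSpace, Fintype.card_fin]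
  rw [measureReal_def, hpre, measurePreserving_head_tail.measure_preimage hT.nullMeasurableSet,
    Measure.prod_apply hT]
  simp_rw [hslice]
  rw [lintegral_indicator hI, setLIntegral_congr hIab, hint, lintegral_mul_const _ (by fun_prop),
    ENNReal.toReal_mul, intervalIntegral.integral_of_le hab, integral_eq_lintegral_of_nonneg_ae
      ((ae_restrict_iff' measurableSet_Ioc).2 (ae_of_all _ fun t ht => pow_nonneg (hf0 t ht) m))
      (by fun_prop), measureReal_def]

/-- Inserting the factor `t / c ≥ 1` turns the integrand into an exact derivative. -/
theorem integral_sqrt_one_sub_sq_pow_le {c : ℝ} (hc : 0 < c) (hc1 : c ≤ 1) :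
    ∫ t in c..1, √(1 - t ^ 2) ^ m ≤ √(1 - c ^ 2) ^ (m + 2) / ((m + 2) * c) := by
  have hsq : ∀ t ∈ Set.Icc c 1, 0 ≤ 1 - t ^ 2 := fun t ht => by
    nlinarith [ht.1, ht.2]
  have hpow : ∀ x : ℝ, 0 ≤ x → ∀ k : ℕ, √x ^ k = x ^ ((k : ℝ) / 2) := fun x hx k => by
    rw [Real.sqrt_eq_rpow, ← Real.rpow_mul_natCast hx]
    ring_nf
  have hder : ∀ t ∈ Set.uIcc c 1, HasDerivAt
      (fun t : ℝ => -((1 - t ^ 2) ^ (((m + 2 : ℕ) : ℝ) / 2) / ((m + 2) * c)))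
      (t / c * (1 - t ^ 2) ^ ((m : ℝ) / 2)) t := by
    intro t _
    have h := ((((hasDerivAt_id t).pow 2).const_sub 1).rpow_const
      (p := ((m + 2 : ℕ) : ℝ) / 2) (Or.inr (by push_cast; linarith [(m.cast_nonneg : (0 : ℝ) ≤ m)])))
    have h' := (h.div_const ((m + 2) * c)).neg
    convert! h' using 1
    have : ((m + 2 : ℕ) : ℝ) / 2 - 1 = (m : ℝ) / 2 := by push_cast; ring
    rw [this]
    have : (m : ℝ) + 2 ≠ 0 := by positivity
    simp only [Pi.pow_apply, id]
    push_cast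
    field_simp
  have hcont : Continuous fun t : ℝ => t / c * (1 - t ^ 2) ^ ((m : ℝ) / 2) := by
    refine Continuous.mul (by fun_prop) (Continuous.rpow_const (by fun_prop) fun t => ?_)
    right; positivity
  have hI := intervalIntegral.integral_eq_sub_of_hasDerivAt hder (hcont.intervalIntegrable _ _)
  calc ∫ t in c..1, √(1 - t ^ 2) ^ m
      ≤ ∫ t in c..1, t / c * (1 - t ^ 2) ^ ((m : ℝ) / 2) := by
        refine intervalIntegral.integral_mono_on hc1
          (Continuous.intervalIntegrable (by fun_prop) _ _) (hcont.intervalIntegrable _ _) ?_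
        intro t ht
        rw [hpow _ (hsq t ht)]
        have h1 : 1 ≤ t / c := (one_le_div hc).2 ht.1
        exact le_mul_of_one_le_left (Real.rpow_nonneg (hsq t ht) _) h1
    _ = √(1 - c ^ 2) ^ (m + 2) / ((m + 2) * c) := by
        rw [hI, hpow _ (hsq c ⟨le_rfl, hc1⟩)]
        have : (0 : ℝ) ^ (((m + 2 : ℕ) : ℝ) / 2) = 0 := Real.zero_rpow (by positivity)
        rw [one_pow, sub_self, this, zero_div, neg_zero, zero_sub, neg_neg]

theorem integral_linear_pow {c : ℝ} (hc : 0 < c) (s : ℝ) :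
    ∫ t in (0 : ℝ)..c, (t * (s / c)) ^ m = s ^ m * c / (m + 1) := by
  simp_rw [mul_pow]
  rw [intervalIntegral.integral_mul_const, integral_pow]
  have : (m : ℝ) + 1 ≠ 0 := by positivity
  have : c ^ m ≠ 0 := pow_ne_zero _ hc.ne'
  rw [zero_pow (Nat.succ_ne_zero m), div_pow, pow_succ]
  field_simp
  ring

/-- The sector contains the straight cone of height `c` and is covered by that cone and the part of
the ball above height `c`. The upper bounds add up neatly because `c² + s² = 1`; the two sides
differ by a factor `c²`, harmless as `c → 1`. -/
theorem volume_sector_bounds {c : ℝ} (hc : 0 < c) (hc1 : c ≤ 1) :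
    √(1 - c ^ 2) ^ m * c / (m + 1) *
        volume.real (Metric.ball (0 : EuclideanSpace ℝ (Fin m)) 1) ≤
      volume.real (sector (EuclideanSpace.single (0 : Fin (m + 1)) (1 : ℝ)) c) ∧
    volume.real (sector (EuclideanSpace.single (0 : Fin (m + 1)) (1 : ℝ)) c) ≤
      √(1 - c ^ 2) ^ m / ((m + 1) * c) *
        volume.real (Metric.ball (0 : EuclideanSpace ℝ (Fin m)) 1) := by
  set s := √(1 - c ^ 2) with hs
  have hs0 : 0 ≤ s := Real.sqrt_nonneg _
  have hs2 : s ^ 2 = 1 - c ^ 2 := Real.sq_sqrt (by nlinarith)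
  have hinner : ∀ z : EuclideanSpace ℝ (Fin (m + 1)),
      inner ℝ (EuclideanSpace.single (0 : Fin (m + 1)) (1 : ℝ)) z = z 0 := fun z => by
    simp [EuclideanSpace.inner_single_left]
  have hA := volume_slices (m := m) hc.le measurableSet_Ioc (ae_eq_refl _)
    (f := fun t => t * (s / c)) (by fun_prop) fun t ht => mul_nonneg ht.1.le (by positivity)
  have hA' := volume_slices (m := m) hc.le measurableSet_Ioo Ioo_ae_eq_Ioc
    (f := fun t => t * (s / c)) (by fun_prop) fun t ht => mul_nonneg ht.1.le (by positivity)
  have hB := volume_slices (m := m) hc1 measurableSet_Ioc (ae_eq_refl _)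
    (f := fun t => √(1 - t ^ 2)) (by fun_prop) fun t ht => Real.sqrt_nonneg _
  simp only [integral_linear_pow hc] at hA hA'
  have hfin : volume (sector (EuclideanSpace.single (0 : Fin (m + 1)) (1 : ℝ)) c) ≠ ⊤ :=
    measure_ne_top_of_subset (fun z hz => by simpa using hz.1)
      (measure_ball_lt_top (x := (0 : EuclideanSpace ℝ (Fin (m + 1)))) (r := 1)).ne
  constructor
  · rw [← hA']
    refine measureReal_mono (fun z hz => ?_) hfin
    obtain ⟨⟨h0, h1⟩, h2⟩ := hz
    have h3 : ‖tail z‖ * c ≤ z 0 * s := by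
      rw [← mul_div_assoc, le_div_iff₀ hc] at h2
      exact h2
    have h4 : (c * ‖z‖) ^ 2 ≤ z 0 ^ 2 := by
      rw [mul_pow, norm_sq_eq_tail]
      have h5 : (‖tail z‖ * c) ^ 2 ≤ (z 0 * s) ^ 2 := by gcongr
      nlinarith
    have h6 : c * ‖z‖ ≤ z 0 := (sq_le_sq₀ (by positivity) h0.le).1 h4
    refine ⟨?_, ?_, ?_⟩
    -- The open interval matters: `c * ‖z‖ ≤ z 0 < c` gives the strict `‖z‖ < 1`.
    · nlinarith
    · rintro rfl
      simp at h0
    · rw [hinner]; exact h6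
  · set V := volume.real (Metric.ball (0 : EuclideanSpace ℝ (Fin m)) 1) with hV
    have hV0 : 0 ≤ V := measureReal_nonneg
    have hsub : sector (EuclideanSpace.single (0 : Fin (m + 1)) (1 : ℝ)) c ⊆
        {z | z 0 ∈ Set.Ioc 0 c ∧ ‖tail z‖ ≤ z 0 * (s / c)} ∪
        {z | z 0 ∈ Set.Ioc c 1 ∧ ‖tail z‖ ≤ √(1 - z 0 ^ 2)} := by
      rintro z ⟨h1, h2, h3⟩
      rw [hinner] at h3
      have hz : 0 < ‖z‖ := norm_pos_iff.2 h2
      have h0 : 0 < z 0 := lt_of_lt_of_le (by positivity) h3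
      have hn := norm_sq_eq_tail z
      have h4 : ‖tail z‖ ^ 2 ≤ 1 - z 0 ^ 2 := by nlinarith
      rcases le_or_gt (z 0) c with h | h
      · left
        refine ⟨⟨h0, h⟩, ?_⟩
        rw [← mul_div_assoc, le_div_iff₀ hc]
        refine (sq_le_sq₀ (by positivity) (by positivity)).1 ?_
        have h5 : (c * ‖z‖) ^ 2 ≤ z 0 ^ 2 := by gcongr
        rw [mul_pow, hn] at h5
        nlinarith
      · right
        refine ⟨⟨h, by nlinarith [sq_nonneg ‖tail z‖]⟩, Real.le_sqrt_of_sq_le h4⟩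
    have hfin2 : ∀ A : Set (EuclideanSpace ℝ (Fin (m + 1))),
        (∀ z ∈ A, ‖z‖ ≤ 1) → volume A ≠ ⊤ := fun A h =>
      measure_ne_top_of_subset (fun z hz => by simpa using h z hz)
        (measure_closedBall_lt_top (x := (0 : EuclideanSpace ℝ (Fin (m + 1)))) (r := 1)).ne
    have hm : (0 : ℝ) < m + 1 := by positivity
    calc _ ≤ _ := measureReal_mono hsub ?_
      _ ≤ _ := measureReal_union_le _ _
      _ = s ^ m * c / (m + 1) * V + (∫ t in c..1, √(1 - t ^ 2) ^ m) * V := by rw [hA, hB]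
      _ ≤ s ^ m * c / (m + 1) * V + s ^ (m + 2) / ((m + 2) * c) * V := by
        gcongr
        exact integral_sqrt_one_sub_sq_pow_le hc hc1
      _ ≤ s ^ m * c / (m + 1) * V + s ^ (m + 2) / ((m + 1) * c) * V := by
        gcongr; norm_num
      _ = _ := by
        rw [pow_add, hs2]
        field_simp
        ring
    refine hfin2 _ fun z hz => ?_
    have hn := norm_sq_eq_tail z
    rcases hz with ⟨⟨h1, h2⟩, h3⟩ | ⟨⟨h1, h2⟩, h3⟩
    · rw [← mul_div_assoc, le_div_iff₀ hc] at h3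
      have h5 : (‖tail z‖ * c) ^ 2 ≤ (z 0 * s) ^ 2 := by gcongr
      have h6 : c ^ 2 * ‖z‖ ^ 2 ≤ c ^ 2 * 1 := by nlinarith
      have h7 : ‖z‖ ^ 2 ≤ 1 := le_of_mul_le_mul_left h6 (by positivity)
      nlinarith [norm_nonneg z]
    · have h4 : ‖tail z‖ ^ 2 ≤ √(1 - z 0 ^ 2) ^ 2 := by gcongr
      rw [Real.sq_sqrt (by nlinarith)] at h4
      nlinarith [norm_nonneg z]

end Slices

/-! ### Cap bounds and the asymptotics of the ball ratio. -/

/-- The quotient of the volumes of the unit balls in dimensions `m` and `m + 1`. -/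
def ballRatio (m : ℕ) : ℝ :=
  volume.real (Metric.ball (0 : EuclideanSpace ℝ (Fin m)) 1) /
    volume.real (Metric.ball (0 : EuclideanSpace ℝ (Fin (m + 1))) 1)

theorem uniformSphere_real_cap_bounds {m : ℕ} {u : EuclideanSpace ℝ (Fin (m + 1))} (hu : ‖u‖ = 1)
    {c : ℝ} (hc : 0 < c) (hc1 : c ≤ 1) :
    ballRatio m / (m + 1) * √(1 - c ^ 2) ^ m * c ≤ (uniformSphere (m + 1)).real
        {y : Sphere (m + 1) | c ≤ inner ℝ u (y : EuclideanSpace ℝ (Fin (m + 1)))} ∧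
    (uniformSphere (m + 1)).real
        {y : Sphere (m + 1) | c ≤ inner ℝ u (y : EuclideanSpace ℝ (Fin (m + 1)))} ≤
      ballRatio m / (m + 1) * √(1 - c ^ 2) ^ m / c := by
  have hpos : 0 < volume.real (Metric.ball (0 : EuclideanSpace ℝ (Fin (m + 1))) 1) :=
    ENNReal.toReal_pos (Metric.measure_ball_pos _ _ one_pos).ne' measure_ball_lt_top.ne
  have hb := volume_sector_bounds (m := m) hc hc1
  rw [uniformSphere_real_cap (Nat.le_add_left 1 m), measureReal_def (s := sector u c),
    volume_sector_eq (u' := EuclideanSpace.single (0 : Fin (m + 1)) (1 : ℝ)) (by simp [hu]),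
    ← measureReal_def, ballRatio]
  constructor
  · refine le_trans (le_of_eq ?_) (div_le_div_of_nonneg_right hb.1 hpos.le)
    field_simp
  · refine (div_le_div_of_nonneg_right hb.2 hpos.le).trans (le_of_eq ?_)
    field_simp

/-- The ratio is a quotient of Gamma values half a unit apart. Log-convexity gives `Γ(x + 1/2)² ≤ x
Γ(x)²`, used at `x = (m+1)/2` for the lower bound and at `x = m/2 + 1` for the upper. -/
theorem sq_ballRatio_bounds {m : ℕ} (hm : 1 ≤ m) :
    (m + 1) / 2 ≤ Real.pi * ballRatio m ^ 2 ∧ Real.pi * ballRatio m ^ 2 ≤ (m + 2) / 2 := by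
  have hne : Nonempty (Fin m) := ⟨⟨0, hm⟩⟩
  have hm0 : (0 : ℝ) < m := by positivity
  have hG : ∀ x : ℝ, 0 < x → 0 < Real.Gamma x := fun x => Real.Gamma_pos_of_pos
  have hlog : ∀ x : ℝ, 0 < x → Real.Gamma (x + 1 / 2) ^ 2 ≤ x * Real.Gamma x ^ 2 := by
    intro x hx
    have h := Real.Gamma_mul_add_mul_le_rpow_Gamma_mul_rpow_Gamma hx (by positivity : 0 < x + 1)
      (by norm_num : (0 : ℝ) < 1 / 2) (by norm_num : (0 : ℝ) < 1 / 2) (by norm_num)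
    rw [Real.Gamma_add_one hx.ne', show 1 / 2 * x + 1 / 2 * (x + 1) = x + 1 / 2 by ring,
      ← Real.sqrt_eq_rpow, ← Real.sqrt_eq_rpow] at h
    calc Real.Gamma (x + 1 / 2) ^ 2
        ≤ (√(Real.Gamma x) * √(x * Real.Gamma x)) ^ 2 := by
          gcongr
      _ = x * Real.Gamma x ^ 2 := by
        rw [mul_pow, Real.sq_sqrt (hG x hx).le, Real.sq_sqrt (by have := hG x hx; positivity)]
        ring
  have hratio : Real.pi * ballRatio m ^ 2 =
      (Real.Gamma (((m : ℝ) + 1) / 2 + 1) / Real.Gamma ((m : ℝ) / 2 + 1)) ^ 2 := by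
    have g1 := hG ((m : ℝ) / 2 + 1) (by positivity)
    have g2 := hG (((m : ℝ) + 1) / 2 + 1) (by positivity)
    have hpi := Real.sq_sqrt Real.pi_pos.le
    have hsp : 0 < √Real.pi := Real.sqrt_pos.2 Real.pi_pos
    rw [ballRatio, measureReal_def, measureReal_def, EuclideanSpace.volume_ball,
      EuclideanSpace.volume_ball]
    simp only [Fintype.card_fin, ENNReal.ofReal_one, one_pow, one_mul]
    rw [ENNReal.toReal_ofReal (by positivity), ENNReal.toReal_ofReal (by push_cast; positivity)]
    push_cast
    rw [pow_succ]
    nth_rewrite 1 [← hpi]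
    field_simp
    ring
  have g1 := hG ((m : ℝ) / 2 + 1) (by positivity)
  rw [hratio, div_pow, le_div_iff₀ (by positivity), div_le_iff₀ (by positivity)]
  constructor
  · have h1 := hlog (((m : ℝ) + 1) / 2) (by positivity)
    have g2 := hG (((m : ℝ) + 1) / 2) (by positivity)
    rw [show ((m : ℝ) + 1) / 2 + 1 / 2 = (m : ℝ) / 2 + 1 by ring] at h1
    rw [Real.Gamma_add_one (s := ((m : ℝ) + 1) / 2) (by positivity)]
    calc _ ≤ ((m : ℝ) + 1) / 2 * (((m : ℝ) + 1) / 2 * Real.Gamma (((m : ℝ) + 1) / 2) ^ 2) := by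
          gcongr
      _ = _ := by ring
  · have h1 := hlog ((m : ℝ) / 2 + 1) (by positivity)
    rw [show (m : ℝ) / 2 + 1 + 1 / 2 = ((m : ℝ) + 1) / 2 + 1 by ring] at h1
    refine h1.trans (le_of_eq (by ring))

theorem tendsto_ballRatio_div_sqrt :
    Tendsto (fun m : ℕ => ballRatio m / √((m : ℝ) + 1)) atTop
      (𝓝 (1 / √(2 * Real.pi))) := by
  have hnn : ∀ m, 0 ≤ ballRatio m / √((m : ℝ) + 1) := fun m =>
    div_nonneg (div_nonneg measureReal_nonneg measureReal_nonneg) (Real.sqrt_nonneg _)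
  have hsq : Tendsto (fun m : ℕ => (ballRatio m / √((m : ℝ) + 1)) ^ 2) atTop
      (𝓝 (1 / (2 * Real.pi))) := by
    have h1 : Tendsto (fun m : ℕ => 1 / (2 * Real.pi) * (1 + 1 / ((m : ℝ) + 1))) atTop
        (𝓝 (1 / (2 * Real.pi))) := by
      have := (tendsto_one_div_add_atTop_nhds_zero_nat (𝕜 := ℝ)).const_add 1
      have := this.const_mul (1 / (2 * Real.pi))
      simpa using this
    refine tendsto_of_tendsto_of_tendsto_of_le_of_le' tendsto_const_nhds h1 ?_ ?_ <;>
    · filter_upwards [eventually_ge_atTop 1] with m hm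
      have hb := sq_ballRatio_bounds hm
      have hpi := Real.pi_pos
      have hm1 : (0 : ℝ) < m + 1 := by positivity
      rw [div_pow, Real.sq_sqrt hm1.le]
      first
      | rw [div_le_div_iff₀ (by positivity) hm1]; linarith [hb.1]
      | rw [div_le_iff₀ hm1]
        have : 1 / (2 * Real.pi) * (1 + 1 / ((m : ℝ) + 1)) * (m + 1) =
            ((m + 2) / 2) / Real.pi := by field_simp; ring
        rw [this, le_div_iff₀ hpi]
        linarith [hb.2]
  have h2 := (Real.continuous_sqrt.tendsto _).comp hsq
  rw [Real.sqrt_div zero_le_one, Real.sqrt_one] at h2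
  exact h2.congr fun m => Real.sqrt_sq (hnn m)

/-! ### Weak convergence from distribution functions. -/

theorem tendstoInDistribution_of_tendsto_real_Iic {Ω : ℕ → Type*} [∀ n, MeasurableSpace (Ω n)]
    {P : ∀ n, Measure (Ω n)} [∀ n, IsProbabilityMeasure (P n)] {Y : ∀ n, Ω n → ℝ}
    {ν : Measure ℝ} [IsProbabilityMeasure ν] (hY : ∀ n, AEMeasurable (Y n) (P n))
    (h : ∀ y, Tendsto (fun n => (P n).real {ω | Y n ω ≤ y}) atTop (𝓝 (cdf ν y))) :
    TendstoInDistribution Y atTop (id : ℝ → ℝ) P ν where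
  forall_aemeasurable := hY
  aemeasurable_limit := aemeasurable_id
  tendsto := by
    -- Half-open intervals form a π-system containing small neighbourhoods of each point, and their
    -- masses are differences of distribution functions.
    refine IsPiSystem.tendsto_probabilityMeasure_of_tendsto_of_mem
      (isPiSystem_Ioc_mem (Set.univ : Set ℝ) Set.univ) ?_ ?_ ?_
    · rintro s ⟨a, -, b, -, -, rfl⟩
      exact measurableSet_Ioc
    · intro u hu x hx
      obtain ⟨ε, hε, hsub⟩ := Metric.isOpen_iff.1 hu x hx
      refine ⟨Set.Ioc (x - ε / 2) (x + ε / 2),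
        ⟨_, Set.mem_univ _, _, Set.mem_univ _, by linarith, rfl⟩,
        Ioc_mem_nhds (by linarith) (by linarith), fun z hz => hsub ?_⟩
      rw [Metric.mem_ball, Real.dist_eq, abs_lt]
      constructor <;> linarith [hz.1, hz.2]
    · rintro s ⟨a, -, b, -, hab, rfl⟩
      rw [← NNReal.tendsto_coe]
      have key : ∀ μ : Measure ℝ, IsProbabilityMeasure μ →
          μ.real (Set.Ioc a b) = μ.real (Set.Iic b) - μ.real (Set.Iic a) := by
        intro μ hμ
        rw [← Set.Iic_sdiff_Iic, measureReal_sdiff (Set.Iic_subset_Iic.2 hab.le) measurableSet_Iic]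
      have hmap : ∀ n y, ((P n).map (Y n)).real (Set.Iic y) = (P n).real {ω | Y n ω ≤ y} := by
        intro n y
        rw [measureReal_def, Measure.map_apply_of_aemeasurable (hY n) measurableSet_Iic]
        rfl
      have hprob : ∀ n, IsProbabilityMeasure ((P n).map (Y n)) := fun n =>
        Measure.isProbabilityMeasure_map (hY n)
      have hlim := (h b).sub (h a)
      rw [cdf_eq_real, cdf_eq_real, ← key ν inferInstance] at hlim
      have e1 : ∀ n, (P n).real {ω | Y n ω ≤ b} - (P n).real {ω | Y n ω ≤ a} =
          ((P n).map (Y n)).real (Set.Ioc a b) := fun n => by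
        rw [key _ (hprob n), hmap, hmap]
      simp_rw [e1] at hlim
      rw [← Measure.map_id (μ := ν)] at hlim
      exact hlim

/-- `extremeCDF` as a Stieltjes function. -/
def extremeStieltjes : StieltjesFunction ℝ where
  toFun := extremeCDF
  mono' := by
    intro x y hxy
    unfold extremeCDF
    have hK : 0 ≤ 1 / (2 * √(2 * Real.pi)) := by positivity
    have : Real.exp (x / 2) ≤ Real.exp (y / 2) := Real.exp_le_exp.2 (by linarith)
    have h2 : Real.exp (-(1 / (2 * √(2 * Real.pi))) * Real.exp (y / 2)) ≤
        Real.exp (-(1 / (2 * √(2 * Real.pi))) * Real.exp (x / 2)) :=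
      Real.exp_le_exp.2 (by nlinarith)
    linarith
  right_continuous' := by
    intro x
    have : Continuous extremeCDF := by unfold extremeCDF; fun_prop
    exact this.continuousWithinAt

theorem tendsto_extremeCDF_atBot : Tendsto extremeCDF atBot (𝓝 0) := by
  have h1 : Tendsto (fun y : ℝ => Real.exp (y / 2)) atBot (𝓝 0) :=
    Real.tendsto_exp_atBot.comp (tendsto_id.atBot_div_const (by norm_num))
  have h2 := (Real.continuous_exp.tendsto _).comp
    (h1.const_mul (-(1 / (2 * √(2 * Real.pi)))))
  have h3 := h2.const_sub 1
  rw [mul_zero, Real.exp_zero, sub_self] at h3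
  exact h3

theorem tendsto_extremeCDF_atTop : Tendsto extremeCDF atTop (𝓝 1) := by
  have h1 : Tendsto (fun y : ℝ => Real.exp (y / 2)) atTop atTop :=
    Real.tendsto_exp_atTop.comp (tendsto_id.atTop_div_const (by norm_num))
  have hK : -(1 / (2 * √(2 * Real.pi))) < 0 := by
    have := Real.pi_pos
    rw [neg_lt_zero]
    positivity
  have h2 := Real.tendsto_exp_atBot.comp (h1.const_mul_atTop_of_neg hK)
  have h3 := h2.const_sub 1
  rw [sub_zero] at h3
  exact h3

theorem convergesWeakly_extremeCDF {Ω : ℕ → Type*} [∀ n, MeasurableSpace (Ω n)]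
    {P : ∀ n, Measure (Ω n)} [∀ n, IsProbabilityMeasure (P n)] {Y : ∀ n, Ω n → ℝ}
    (hY : ∀ n, AEMeasurable (Y n) (P n))
    (h : ∀ y, Tendsto (fun n => (P n).real {ω | y < Y n ω}) atTop (𝓝 (1 - extremeCDF y))) :
    ConvergesWeakly P Y extremeCDF := by
  have hprob : IsProbabilityMeasure extremeStieltjes.measure :=
    StieltjesFunction.isProbabilityMeasure _ tendsto_extremeCDF_atBot tendsto_extremeCDF_atTop
  have hcdf : ∀ y, cdf extremeStieltjes.measure y = extremeCDF y := fun y => by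
    rw [cdf_measure_stieltjesFunction _ tendsto_extremeCDF_atBot tendsto_extremeCDF_atTop]
    rfl
  refine ⟨extremeStieltjes.measure, hprob, hcdf,
    tendstoInDistribution_of_tendsto_real_Iic hY fun y => ?_⟩
  have := (h y).const_sub 1
  rw [sub_sub_cancel, ← hcdf] at this
  refine this.congr fun n => ?_
  have hm : NullMeasurableSet {ω | y < Y n ω} (P n) :=
    (hY n).nullMeasurableSet_preimage measurableSet_Ioi
  rw [← probReal_compl_eq_one_sub₀ hm]
  congr 1
  ext ω
  simp

theorem one_sub_extremeCDF (y : ℝ) :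
    1 - extremeCDF y = Real.exp (-(1 / √(2 * Real.pi) * Real.exp (y / 2) / 2)) := by
  rw [extremeCDF, sub_sub_cancel]
  congr 1
  field_simp

/-! ### Cap probabilities and extreme angles for both signs. -/

/-- The probability that a uniform point has inner product at least `c` with a fixed unit
vector. -/
def capProb (p : ℕ) (c : ℝ) : ℝ :=
  ⨆ x : Sphere p, (uniformSphere p).real
    {y : Sphere p | c ≤ inner ℝ (x : EuclideanSpace ℝ (Fin p)) (y : EuclideanSpace ℝ (Fin p))}

/-- The supremum in `capProb` runs over a constant family; it merely avoids choosing a base point.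
-/
theorem uniformSphere_real_cap_eq {p : ℕ} (hp : 1 ≤ p) {u : EuclideanSpace ℝ (Fin p)}
    (hu : ‖u‖ = 1) (c : ℝ) :
    (uniformSphere p).real {y : Sphere p | c ≤ inner ℝ u (y : EuclideanSpace ℝ (Fin p))} =
      capProb p c := by
  have : Nonempty (Sphere p) := ⟨⟨u, by simpa using hu⟩⟩
  rw [capProb, ← ciSup_const (ι := Sphere p) (a := (uniformSphere p).real _)]
  congr 1
  ext x
  rw [uniformSphere_real_cap hp, uniformSphere_real_cap hp, measureReal_def, measureReal_def,
    measureReal_def, volume_sector_eq (u := u) (u' := x) (by simp [hu])]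

/-- Pairs of points `x`, `y` such that `σ x` and `y` have inner product at least `c`. -/
def signedClose (σ : ℝ) (p : ℕ) (c : ℝ) : Set (Sphere p × Sphere p) :=
  {z | c ≤ σ * inner ℝ (z.1 : EuclideanSpace ℝ (Fin p)) (z.2 : EuclideanSpace ℝ (Fin p))}

theorem measurableSet_signedClose (σ : ℝ) (p : ℕ) (c : ℝ) :
    MeasurableSet (signedClose σ p c) :=
  measurableSet_le measurable_const (by fun_prop)

theorem real_signedClose_left {σ : ℝ} (hσ : |σ| = 1) {p : ℕ} (hp : 1 ≤ p) (c : ℝ) (x : Sphere p) :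
    (uniformSphere p).real {y | (x, y) ∈ signedClose σ p c} = capProb p c := by
  rw [← uniformSphere_real_cap_eq hp (u := σ • (x : EuclideanSpace ℝ (Fin p)))
    (by simp [norm_smul, hσ])]
  simp [signedClose, inner_smul_left]

theorem real_signedClose_right {σ : ℝ} (hσ : |σ| = 1) {p : ℕ} (hp : 1 ≤ p) (c : ℝ)
    (y : Sphere p) :
    (uniformSphere p).real {x | (x, y) ∈ signedClose σ p c} = capProb p c := by
  rw [← real_signedClose_left hσ hp c y]
  simp [signedClose, real_inner_comm]

theorem pow_le_capProb {p : ℕ} (hp : 1 ≤ p) {ε : ℝ} (hε : 0 < ε) (hε2 : ε ≤ 2) :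
    (ε / 4) ^ p ≤ capProb p (1 - ε ^ 2 / 2) := by
  have hu : ‖EuclideanSpace.single (⟨0, hp⟩ : Fin p) (1 : ℝ)‖ = 1 := by simp
  rw [← uniformSphere_real_cap_eq hp hu]
  exact pow_le_uniformSphere_real_cap hp hu hε hε2

theorem capProb_bounds {p : ℕ} (hp : 1 ≤ p) {c : ℝ} (hc : 0 < c) (hc1 : c ≤ 1) :
    ballRatio (p - 1) / p * √(1 - c ^ 2) ^ (p - 1) * c ≤ capProb p c ∧
      capProb p c ≤ ballRatio (p - 1) / p * √(1 - c ^ 2) ^ (p - 1) / c := by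
  obtain ⟨m, rfl⟩ := Nat.exists_eq_add_of_le' hp
  have hu : ‖EuclideanSpace.single (0 : Fin (m + 1)) (1 : ℝ)‖ = 1 := by simp
  rw [← uniformSphere_real_cap_eq hp hu]
  simpa using uniformSphere_real_cap_bounds hu hc hc1

theorem capProb_one {p : ℕ} (hp : 2 ≤ p) : capProb p 1 = 0 := by
  have h := capProb_bounds (p := p) (by omega) one_pos le_rfl
  have : p - 1 ≠ 0 := by omega
  simp only [one_pow, sub_self, Real.sqrt_zero, zero_pow this, mul_zero, zero_mul,
    zero_div] at h
  exact le_antisymm h.2 h.1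

/-- The smallest angle between `σ x i` and `x j` over the pairs `i < j`. -/
def signedMin (σ : ℝ) {n p : ℕ} (x : Fin n → Sphere p) : ℝ :=
  ⨅ q : Pairs n, Real.arccos
    (σ * inner ℝ (x q.1.1 : EuclideanSpace ℝ (Fin p)) (x q.1.2 : EuclideanSpace ℝ (Fin p)))

theorem Θ_eq_arccos {n p : ℕ} (x : Fin n → Sphere p) (q : Pairs n) :
    Θ x q = Real.arccos
      (inner ℝ (x q.1.1 : EuclideanSpace ℝ (Fin p)) (x q.1.2 : EuclideanSpace ℝ (Fin p))) := by
  simp [Θ, InnerProductGeometry.angle]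

theorem Θmin_eq_signedMin {n p : ℕ} (x : Fin n → Sphere p) : Θmin x = signedMin 1 x := by
  simp [Θmin, signedMin, Θ_eq_arccos]

theorem nonempty_pairs {n : ℕ} (hn : 2 ≤ n) : Nonempty (Pairs n) :=
  ⟨⟨(⟨0, by omega⟩, ⟨1, by omega⟩), by simp [Fin.lt_def]⟩⟩

/-- Without a pair both extrema default to `0` and the identity fails, hence `2 ≤ n`. -/
theorem Θmax_eq_pi_sub_signedMin {n p : ℕ} (hn : 2 ≤ n) (x : Fin n → Sphere p) :
    Θmax x = Real.pi - signedMin (-1) x := by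
  have := nonempty_pairs hn
  have hfin := Set.finite_range fun q : Pairs n => Θ x q
  obtain ⟨q, hq⟩ := exists_eq_ciSup_of_finite (f := fun q : Pairs n => Θ x q)
  have hΘ : ∀ q : Pairs n, Real.arccos (-1 * inner ℝ (x q.1.1 : EuclideanSpace ℝ (Fin p))
      (x q.1.2 : EuclideanSpace ℝ (Fin p))) = Real.pi - Θ x q := fun q => by
    rw [neg_one_mul, Real.arccos_neg, Θ_eq_arccos]
  have hmin : signedMin (-1) x = Real.pi - Θ x q := by
    simp only [signedMin, hΘ]
    refine le_antisymm (ciInf_le (Set.finite_range _).bddBelow q) (le_ciInf fun q' => ?_)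
    have : Θ x q' ≤ Θ x q := hq ▸ le_ciSup hfin.bddAbove q'
    linarith
  rw [hmin, sub_sub_cancel, Θmax]
  exact hq.symm

theorem signedMin_nonneg (σ : ℝ) {n p : ℕ} (x : Fin n → Sphere p) : 0 ≤ signedMin σ x :=
  Real.iInf_nonneg fun _ => Real.arccos_nonneg _

/-- Cosine is strictly decreasing on `[0, π]`, and the infimum over finitely many pairs is attained,
so strictness survives. -/
theorem lt_signedMin_iff {σ : ℝ} (hσ : |σ| = 1) {n p : ℕ} (hn : 2 ≤ n) (x : Fin n → Sphere p)
    {t : ℝ} (ht0 : 0 ≤ t) (htπ : t ≤ Real.pi) :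
    t < signedMin σ x ↔ x ∈ avoid (signedClose σ p (Real.cos t)) n := by
  have := nonempty_pairs hn
  have habs : ∀ i j, |σ * inner ℝ (x i : EuclideanSpace ℝ (Fin p))
      (x j : EuclideanSpace ℝ (Fin p))| ≤ 1 := fun i j => by
    rw [abs_mul, hσ, one_mul]
    simpa using abs_real_inner_le_norm (x i : EuclideanSpace ℝ (Fin p))
      (x j : EuclideanSpace ℝ (Fin p))
  have hone : ∀ i j, t < Real.arccos (σ * inner ℝ (x i : EuclideanSpace ℝ (Fin p))
      (x j : EuclideanSpace ℝ (Fin p))) ↔ (x i, x j) ∉ signedClose σ p (Real.cos t) := by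
    intro i j
    have hb := abs_le.1 (habs i j)
    simp only [signedClose, Set.mem_ofPred_eq, not_le]
    rw [← Real.strictAntiOn_cos.lt_iff_gt
      ⟨Real.arccos_nonneg _, Real.arccos_le_pi _⟩ ⟨ht0, htπ⟩, Real.cos_arccos hb.1 hb.2]
  obtain ⟨q, hq⟩ := exists_eq_ciInf_of_finite (f := fun q : Pairs n => Real.arccos
    (σ * inner ℝ (x q.1.1 : EuclideanSpace ℝ (Fin p)) (x q.1.2 : EuclideanSpace ℝ (Fin p))))
  constructor
  · intro h i j hij
    exact (hone i j).1 (h.trans_le (ciInf_le (Set.finite_range _).bddBelow (⟨(i, j), hij⟩ : Pairs n)))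
  · intro h
    rw [signedMin, ← hq]
    exact (hone _ _).2 (h _ _ q.2)

theorem measurable_signedMin (σ : ℝ) (n p : ℕ) :
    Measurable fun x : Fin n → Sphere p => signedMin σ x := by
  unfold signedMin
  refine Measurable.iInf fun q => Real.continuous_arccos.measurable.comp ?_
  fun_prop

theorem measurable_Θmax (n p : ℕ) : Measurable fun x : Fin n → Sphere p => Θmax x := by
  unfold Θmax
  simp_rw [Θ_eq_arccos]
  refine Measurable.iSup fun q => Real.continuous_arccos.measurable.comp ?_
  fun_prop

theorem measurable_normalized (n p : ℕ) : Measurable (normalized n p) := by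
  unfold normalized
  fun_prop

section Sample

variable {Ω : Type*} [MeasurableSpace Ω] {P : Measure Ω} [IsProbabilityMeasure P] {n p : ℕ}
  {X : Fin n → Ω → Sphere p}

theorem real_sample_mem_avoid (hunif : ∀ i, HasLaw (X i) (uniformSphere p) P)
    (hindep : iIndepFun X P) {R : Set (Sphere p × Sphere p)} (hR : MeasurableSet R) :
    P.real {ω | (fun i => X i ω) ∈ avoid R n} = avoidProb (uniformSphere p) R n := by
  have hm : ∀ i, AEMeasurable (X i) P := fun i => (hunif i).aemeasurable
  have h := (iIndepFun_iff_map_fun_eq_pi_map hm).1 hindep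
  simp_rw [fun i => (hunif i).map_eq] at h
  rw [avoidProb, measureReal_def, measureReal_def, ← h,
    Measure.map_apply_of_aemeasurable (aemeasurable_pi_lambda _ hm) (measurableSet_avoid hR n)]
  rfl

theorem real_lt_signedMin {σ : ℝ} (hσ : |σ| = 1) (hn : 2 ≤ n)
    (hunif : ∀ i, HasLaw (X i) (uniformSphere p) P) (hindep : iIndepFun X P)
    {t : ℝ} (ht0 : 0 ≤ t) (htπ : t ≤ Real.pi) :
    P.real {ω | t < signedMin σ fun i => X i ω} =
      avoidProb (uniformSphere p) (signedClose σ p (Real.cos t)) n := by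
  rw [← real_sample_mem_avoid hunif hindep (measurableSet_signedClose _ _ _)]
  simp_rw [lt_signedMin_iff hσ hn _ ht0 htπ]

end Sample

/-! ### Asymptotics along the sequence of dimensions. -/

section Limits

variable {p : ℕ → ℕ}

theorem eventually_one_le (hp : Tendsto (fun n : ℕ => Real.log n / (p n : ℝ)) atTop atTop) :
    ∀ᶠ n in atTop, 1 ≤ p n := by
  filter_upwards [hp.eventually_gt_atTop 0] with n hn
  by_contra h
  -- Division by zero gives `0`, contradicting the positive quotient.
  have : p n = 0 := by omega
  simp [this] at hn

/-- Eventually `-p log r ≤ (log n) / 2`, so the product is at least `√n`. -/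
theorem tendsto_mul_pow (hp : Tendsto (fun n : ℕ => Real.log n / (p n : ℝ)) atTop atTop)
    {r : ℝ} (hr : 0 < r) : Tendsto (fun n : ℕ => (n : ℝ) * r ^ p n) atTop atTop := by
  have hlog : Tendsto (fun n : ℕ => Real.log n / 2) atTop atTop :=
    (Real.tendsto_log_atTop.comp tendsto_natCast_atTop_atTop).atTop_div_const two_pos
  refine tendsto_atTop_mono' _ ?_ (Real.tendsto_exp_atTop.comp hlog)
  filter_upwards [hp.eventually_ge_atTop (-2 * Real.log r), eventually_one_le hp,
    eventually_ge_atTop 1] with n hn hpn hn1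
  have hpn' : (0 : ℝ) < p n := by exact_mod_cast hpn
  have hn0 : (0 : ℝ) < n := by exact_mod_cast hn1
  rw [le_div_iff₀ hpn'] at hn
  calc Real.exp (Real.log n / 2) ≤ Real.exp (Real.log n + p n * Real.log r) :=
        Real.exp_le_exp.2 (by nlinarith)
    _ = n * r ^ p n := by
      rw [Real.exp_add, Real.exp_log hn0, mul_comm (p n : ℝ), ← Real.rpow_def_of_pos hr,
        Real.rpow_natCast]

theorem tendsto_avoidProb_of_lt_one {σ : ℝ} (hσ : |σ| = 1)
    (hp : Tendsto (fun n : ℕ => Real.log n / (p n : ℝ)) atTop atTop) {c : ℝ} (hc : -1 ≤ c)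
    (hc1 : c < 1) :
    Tendsto (fun n => avoidProb (uniformSphere (p n)) (signedClose σ (p n) c) n) atTop (𝓝 0) := by
  have hp1 := eventually_one_le hp
  set ε := √(2 * (1 - c)) with hε
  have hε0 : 0 < ε := Real.sqrt_pos.2 (by linarith)
  have hεsq : ε ^ 2 = 2 * (1 - c) := Real.sq_sqrt (by linarith)
  have hε2 : ε ≤ 2 := by nlinarith
  have hcε : c = 1 - ε ^ 2 / 2 := by linarith
  refine tendsto_avoidProb_zero (v := fun n => capProb (p n) c) _
    (hp1.mono fun n h => isProbabilityMeasure_uniformSphere h)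
    (fun n => measurableSet_signedClose _ _ _)
    (hp1.mono fun n h => real_signedClose_left hσ h c) ?_
  refine tendsto_atTop_mono' _ ?_ (tendsto_mul_pow hp (show 0 < ε / 4 by positivity))
  filter_upwards [hp1] with n h
  gcongr
  rw [hcε]
  exact pow_le_capProb h hε0 hε2

/-- Coincident (or antipodal) points have probability zero once `p ≥ 2`; this later discards a zero
angle. -/
theorem tendsto_avoidProb_one {σ : ℝ} (hσ : |σ| = 1) (hp : Tendsto p atTop atTop) :
    Tendsto (fun n => avoidProb (uniformSphere (p n)) (signedClose σ (p n) 1) n) atTop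
      (𝓝 1) := by
  have hp2 : ∀ᶠ n in atTop, 2 ≤ p n := hp.eventually_ge_atTop 2
  have h := tendsto_avoidProb_exp (v := fun _ => 0) (L := 0)
    (R := fun n => signedClose σ (p n) 1) (fun n => uniformSphere (p n))
    (hp2.mono fun n h => isProbabilityMeasure_uniformSphere (by omega))
    (fun n => measurableSet_signedClose _ _ _)
    (hp2.mono fun n h x => by rw [real_signedClose_left hσ (by omega), capProb_one h])
    (hp2.mono fun n h x => by rw [real_signedClose_right hσ (by omega), capProb_one h])
    (by simp)
  simpa using h

/-- The sine of an angle whose normalization is `y`. -/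
def sineLevel (n p : ℕ) (y : ℝ) : ℝ :=
  Real.exp ((y + Real.log p - 4 * (p : ℝ) / ((p : ℝ) - 1) * Real.log n) / (2 * p))

theorem lt_normalized_iff {n p : ℕ} (hp : 1 ≤ p) {y θ : ℝ} (hθ : 0 < Real.sin θ) :
    y < normalized n p θ ↔ sineLevel n p y < Real.sin θ := by
  have hp' : (0 : ℝ) < 2 * p := by positivity
  rw [sineLevel, ← Real.lt_log_iff_exp_lt hθ, div_lt_iff₀ hp', normalized]
  constructor <;> intro h <;> linarith

theorem tendsto_add_log_div (hp : Tendsto p atTop atTop) (y : ℝ) :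
    Tendsto (fun n => (y + Real.log (p n)) / (2 * p n)) atTop (𝓝 0) := by
  have hpR : Tendsto (fun n => (p n : ℝ)) atTop atTop := tendsto_natCast_atTop_atTop.comp hp
  have h1 : Tendsto (fun n => y / (2 * p n : ℝ)) atTop (𝓝 0) :=
    tendsto_const_nhds.div_atTop (hpR.const_mul_atTop two_pos)
  have h2 : Tendsto (fun n => Real.log (p n) / (p n : ℝ)) atTop (𝓝 0) :=
    (Real.isLittleO_log_id_atTop.tendsto_div_nhds_zero).comp hpR
  have h3 := h1.add (h2.div_const 2)
  rw [zero_div, add_zero] at h3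
  refine h3.congr fun n => ?_
  ring

theorem tendsto_sineLevel (hp : Tendsto p atTop atTop)
    (hlog : Tendsto (fun n : ℕ => Real.log n / (p n : ℝ)) atTop atTop) (y : ℝ) :
    Tendsto (fun n => sineLevel n (p n) y) atTop (𝓝 0) := by
  have hdiv : Tendsto (fun n : ℕ => Real.log n / ((p n : ℝ) - 1)) atTop atTop := by
    refine tendsto_atTop_mono' _ ?_ hlog
    filter_upwards [hp.eventually_ge_atTop 2, eventually_ge_atTop 1] with n hpn hn
    have h2 : (2 : ℝ) ≤ p n := by exact_mod_cast hpn
    have h1 : 0 ≤ Real.log n := Real.log_natCast_nonneg n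
    gcongr
    · linarith
    · linarith
  refine Real.tendsto_exp_atBot.comp ?_
  have h := (tendsto_add_log_div hp y).add_atBot
    (tendsto_neg_atTop_atBot.comp (hdiv.const_mul_atTop two_pos))
  refine h.congr' ?_
  filter_upwards [hp.eventually_ge_atTop 2] with n hpn
  have h2 : (2 : ℝ) ≤ p n := by exact_mod_cast hpn
  have h3 : (p n : ℝ) - 1 ≠ 0 := by linarith
  simp only [Function.comp_apply]
  field_simp
  ring

/-- The coefficient `4p/(p-1)` makes the power contain exactly `n⁻²`; the last factor comes from
`(p-1)/(2p) = 1/2 - 1/(2p)`. -/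
theorem sq_mul_sineLevel_pow {n p : ℕ} (hn : 1 ≤ n) (hp : 2 ≤ p) (y : ℝ) :
    (n : ℝ) ^ 2 * sineLevel n p y ^ (p - 1) =
      √p * Real.exp (y / 2) * Real.exp (-((y + Real.log p) / (2 * p))) := by
  have hn0 : (0 : ℝ) < n := by exact_mod_cast hn
  have hp2 : (2 : ℝ) ≤ p := by exact_mod_cast hp
  have hp0 : (0 : ℝ) < p := by linarith
  have h3 : (p : ℝ) - 1 ≠ 0 := by linarith
  have e1 : (n : ℝ) ^ 2 = Real.exp (2 * Real.log n) := by
    rw [mul_comm, ← Real.rpow_def_of_pos hn0]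
    norm_cast
  have e2 : √(p : ℝ) = Real.exp (Real.log p / 2) := by
    rw [← Real.log_sqrt hp0.le, Real.exp_log (Real.sqrt_pos.2 hp0)]
  rw [e1, e2, sineLevel, ← Real.exp_nat_mul, ← Real.exp_add, ← Real.exp_add, ← Real.exp_add,
    Nat.cast_sub (by omega)]
  congr 1
  push_cast
  field_simp
  ring

theorem tendsto_sq_mul_capProb (hp : Tendsto p atTop atTop)
    (hlog : Tendsto (fun n : ℕ => Real.log n / (p n : ℝ)) atTop atTop) (y : ℝ) :
    Tendsto (fun n : ℕ => (n : ℝ) ^ 2 *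
      capProb (p n) (Real.cos (Real.arcsin (sineLevel n (p n) y)))) atTop
      (𝓝 (1 / √(2 * Real.pi) * Real.exp (y / 2))) := by
  have hs := tendsto_sineLevel hp hlog y
  set s : ℕ → ℝ := fun n => sineLevel n (p n) y with hsdef
  set c : ℕ → ℝ := fun n => Real.cos (Real.arcsin (s n)) with hcdef
  have hc : Tendsto c atTop (𝓝 1) := by
    have := ((Real.continuous_cos.comp Real.continuous_arcsin).tendsto 0).comp hs
    rw [Function.comp_apply, Real.arcsin_zero, Real.cos_zero] at this
    exact this
  have hpred : Tendsto (fun n => p n - 1) atTop atTop :=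
    (tendsto_sub_atTop_nat 1).comp hp
  have hmain : Tendsto (fun n : ℕ => (n : ℝ) ^ 2 *
      (ballRatio (p n - 1) / p n * s n ^ (p n - 1))) atTop
      (𝓝 (1 / √(2 * Real.pi) * Real.exp (y / 2))) := by
    have h1 := tendsto_ballRatio_div_sqrt.comp hpred
    have h2 := (Real.continuous_exp.tendsto _).comp (tendsto_add_log_div hp y).neg
    rw [neg_zero, Real.exp_zero] at h2
    have h3 := (h1.mul_const (Real.exp (y / 2))).mul h2
    rw [mul_one] at h3
    refine h3.congr' ?_
    filter_upwards [hp.eventually_ge_atTop 2, eventually_ge_atTop 1] with n hpn hn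
    have e := sq_mul_sineLevel_pow hn hpn y
    have hp0 : (0 : ℝ) < p n := by positivity
    have hsq : √(p n : ℝ) ^ 2 = p n := Real.sq_sqrt hp0.le
    have hs0 : √(p n : ℝ) ≠ 0 := (Real.sqrt_pos.2 hp0).ne'
    have hcast : ((p n - 1 : ℕ) : ℝ) + 1 = p n := by
      rw [Nat.cast_sub (by omega)]; simp
    simp only [Function.comp_apply, hcast]
    calc _ = ballRatio (p n - 1) / (√(p n : ℝ) ^ 2) * (√(p n : ℝ) * Real.exp (y / 2) *
          Real.exp (-((y + Real.log (p n)) / (2 * p n)))) := by field_simp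
      _ = _ := by rw [← e, hsq]; ring
  have hlow := hmain.mul hc
  have hupp := hmain.div hc one_ne_zero
  rw [mul_one] at hlow
  rw [div_one] at hupp
  have hb : ∀ᶠ n in atTop, 0 < c n ∧ c n ≤ 1 ∧ √(1 - c n ^ 2) = s n ∧ 1 ≤ p n := by
    filter_upwards [hc.eventually_const_lt one_pos, hs.eventually_lt_const one_pos,
      hp.eventually_ge_atTop 1] with n hcn hsn hpn
    refine ⟨hcn, Real.cos_le_one _, ?_, hpn⟩
    have hs0 : 0 < s n := Real.exp_pos _
    have : 1 - c n ^ 2 = s n ^ 2 := by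
      rw [← Real.sin_arcsin (by linarith) hsn.le, Real.sin_sq]
    rw [this, Real.sqrt_sq hs0.le]
  refine tendsto_of_tendsto_of_tendsto_of_le_of_le' hlow hupp ?_ ?_ <;>
  · filter_upwards [hb] with n ⟨hc0, hc1, hsn, hpn⟩
    have h := capProb_bounds hpn hc0 hc1
    rw [hsn] at h
    simp only [Pi.div_apply, mul_div_assoc, mul_assoc] at h ⊢
    first
    | exact mul_le_mul_of_nonneg_left h.1 (by positivity)
    | exact mul_le_mul_of_nonneg_left h.2 (by positivity)

end Limits

/-! ### Limit laws for the signed minimum. -/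

section Main

variable {Ω : ℕ → Type*} [∀ n, MeasurableSpace (Ω n)]
    {P : ∀ n, Measure (Ω n)} [∀ n, IsProbabilityMeasure (P n)]
    {p : ℕ → ℕ} {X : ∀ n, Fin n → Ω n → Sphere (p n)}

theorem tendsto_real_le_signedMin {σ : ℝ} (hσ : |σ| = 1)
    (hunif : ∀ n i, HasLaw (X n i) (uniformSphere (p n)) (P n))
    (hindep : ∀ n, iIndepFun (X n) (P n))
    (hlog : Tendsto (fun n : ℕ => Real.log n / (p n : ℝ)) atTop atTop) {ε : ℝ} (hε : 0 < ε) :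
    Tendsto (fun n => (P n).real {ω | ε ≤ signedMin σ fun i => X n i ω}) atTop (𝓝 0) := by
  -- Strictly below `ε`, to pass from `ε ≤ signedMin` to a strict inequality, and below `π`.
  set t := min (ε / 2) 1 with ht
  have ht0 : 0 < t := lt_min (by positivity) one_pos
  have htπ : t < Real.pi := (min_le_right _ _).trans_lt (by linarith [Real.pi_gt_three])
  have htε : t < ε := (min_le_left _ _).trans_lt (by linarith)
  have hcos : Real.cos t < 1 := by
    rw [← Real.cos_zero]
    exact Real.cos_lt_cos_of_nonneg_of_le_pi le_rfl htπ.le ht0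
  refine tendsto_of_tendsto_of_tendsto_of_le_of_le' tendsto_const_nhds
    (tendsto_avoidProb_of_lt_one hσ hlog (Real.neg_one_le_cos t) hcos)
    (Eventually.of_forall fun n => measureReal_nonneg) ?_
  filter_upwards [eventually_ge_atTop 2] with n hn
  rw [← real_lt_signedMin hσ hn (hunif n) (hindep n) ht0.le htπ.le]
  exact measureReal_mono fun ω hω => htε.trans_le hω

theorem tendsto_real_lt_normalized_signedMin {σ : ℝ} (hσ : |σ| = 1)
    (hunif : ∀ n i, HasLaw (X n i) (uniformSphere (p n)) (P n))
    (hindep : ∀ n, iIndepFun (X n) (P n))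
    (hlog : Tendsto (fun n : ℕ => Real.log n / (p n : ℝ)) atTop atTop)
    (hp : Tendsto p atTop atTop) (y : ℝ) :
    Tendsto (fun n => (P n).real
      {ω | y < normalized n (p n) (signedMin σ fun i => X n i ω)}) atTop
      (𝓝 (1 - extremeCDF y)) := by
  have hp1 : ∀ᶠ n in atTop, 1 ≤ p n := hp.eventually_ge_atTop 1
  have hA := tendsto_avoidProb_exp
    (R := fun n => signedClose σ (p n) (Real.cos (Real.arcsin (sineLevel n (p n) y))))
    (fun n => uniformSphere (p n))
    (hp1.mono fun n h => isProbabilityMeasure_uniformSphere h)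
    (fun n => measurableSet_signedClose _ _ _)
    (hp1.mono fun n h => real_signedClose_left hσ h _)
    (hp1.mono fun n h => real_signedClose_right hσ h _)
    (tendsto_sq_mul_capProb hp hlog y)
  rw [← one_sub_extremeCDF] at hA
  have hlow := hA.sub (tendsto_real_le_signedMin hσ hunif hindep hlog
    (show 0 < Real.pi / 2 by positivity))
  have hupp := hA.add ((tendsto_avoidProb_one hσ hp).const_sub 1)
  rw [sub_zero] at hlow
  rw [sub_self, add_zero] at hupp
  have hev : ∀ᶠ n in atTop, sineLevel n (p n) y < 1 ∧ 1 ≤ p n ∧ 2 ≤ n :=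
    ((tendsto_sineLevel hp hlog y).eventually_lt_const one_pos).and
      (hp1.and (eventually_ge_atTop 2))
  refine tendsto_of_tendsto_of_tendsto_of_le_of_le' hlow hupp ?_ ?_
  · filter_upwards [hev] with n ⟨hs1, hpn, hn⟩
    have hs0 : 0 < sineLevel n (p n) y := Real.exp_pos _
    rw [← real_lt_signedMin hσ hn (hunif n) (hindep n) (Real.arcsin_nonneg.2 hs0.le)
      ((Real.arcsin_le_pi_div_two _).trans (by linarith [Real.pi_pos])), sub_le_iff_le_add]
    -- Sine increases only up to `π / 2`; larger minima form an event of vanishing probability.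
    refine le_trans (measureReal_mono fun ω hω => ?_) (measureReal_union_le _ _)
    rcases le_or_gt (Real.pi / 2) (signedMin σ fun i => X n i ω) with h | h
    · exact Or.inr h
    · left
      simp only [Set.mem_ofPred_eq] at hω ⊢
      have hsin : sineLevel n (p n) y < Real.sin (signedMin σ fun i => X n i ω) := by
        rw [← Real.sin_arcsin (by linarith) hs1.le]
        exact Real.sin_lt_sin_of_lt_of_le_pi_div_two (Real.neg_pi_div_two_le_arcsin _) h.le hω
      exact (lt_normalized_iff hpn (hs0.trans hsin)).2 hsin
  · filter_upwards [hev] with n ⟨hs1, hpn, hn⟩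
    have hs0 : 0 < sineLevel n (p n) y := Real.exp_pos _
    have hXm : AEMeasurable (fun ω => signedMin σ fun i => X n i ω) (P n) :=
      (measurable_signedMin σ n (p n)).comp_aemeasurable (f := fun ω i => X n i ω)
        (aemeasurable_pi_lambda _ fun i => (hunif n i).aemeasurable)
    have hm : NullMeasurableSet {ω | 0 < signedMin σ fun i => X n i ω} (P n) :=
      hXm.nullMeasurableSet_preimage measurableSet_Ioi
    have hpos := real_lt_signedMin hσ hn (hunif n) (hindep n) le_rfl Real.pi_pos.le
    rw [Real.cos_zero] at hpos
    rw [← hpos, ← probReal_compl_eq_one_sub₀ hm,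
      ← real_lt_signedMin hσ hn (hunif n) (hindep n) (Real.arcsin_nonneg.2 hs0.le)
      ((Real.arcsin_le_pi_div_two _).trans (by linarith [Real.pi_pos]))]
    -- At a zero minimum `Real.log 0 = 0` instead of `-∞`, so that event is split off.
    refine le_trans (measureReal_mono fun ω hω => ?_) (measureReal_union_le _ _)
    by_cases h0 : 0 < signedMin σ fun i => X n i ω
    · left
      simp only [Set.mem_ofPred_eq] at hω ⊢
      by_contra! hle
      have hlt : (signedMin σ fun i => X n i ω) < Real.pi :=
        (hle.trans (Real.arcsin_le_pi_div_two _)).trans_lt (by linarith [Real.pi_pos])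
      have hsin := (lt_normalized_iff hpn (Real.sin_pos_of_pos_of_lt_pi h0 hlt)).1 hω
      have : Real.sin (signedMin σ fun i => X n i ω) ≤ sineLevel n (p n) y := by
        rw [← Real.sin_arcsin (x := sineLevel n (p n) y) (by linarith) hs1.le]
        exact Real.sin_le_sin_of_le_of_le_pi_div_two (by linarith [Real.pi_pos])
          (Real.arcsin_le_pi_div_two _) hle
      linarith
    · exact Or.inr h0

end Main

end RandomAngles

end

theorem theorem7 {Ω : ℕ → Type*} [∀ n, MeasurableSpace (Ω n)]
    (P : ∀ n, Measure (Ω n)) [∀ n, IsProbabilityMeasure (P n)]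
    (p : ℕ → ℕ) (X : ∀ n, Fin n → Ω n → RandomAngles.Sphere (p n))
    (hunif : ∀ n i, HasLaw (X n i) (RandomAngles.uniformSphere (p n)) (P n))
    (hindep : ∀ n, iIndepFun (X n) (P n))
    (hp : Tendsto (fun n : ℕ => Real.log n / (p n : ℝ)) atTop atTop) :
    (RandomAngles.ConvergesInProbability P
        (fun n ω => RandomAngles.Θmin (fun i => X n i ω)) 0 ∧
      RandomAngles.ConvergesInProbability P
        (fun n ω => RandomAngles.Θmax (fun i => X n i ω)) Real.pi) ∧
    (Tendsto p atTop atTop →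
      RandomAngles.ConvergesWeakly P
        (fun n ω => RandomAngles.normalized n (p n) (RandomAngles.Θmin (fun i => X n i ω)))
        RandomAngles.extremeCDF ∧
      RandomAngles.ConvergesWeakly P
        (fun n ω => RandomAngles.normalized n (p n) (RandomAngles.Θmax (fun i => X n i ω)))
        RandomAngles.extremeCDF) := by
  have hX : ∀ n, AEMeasurable (fun ω i => X n i ω) (P n) := fun n =>
    aemeasurable_pi_lambda _ fun i => (hunif n i).aemeasurable
  have h1 : |(1 : ℝ)| = 1 := abs_one
  have h2 : |(-1 : ℝ)| = 1 := by simp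
  refine ⟨⟨fun ε hε => ?_, fun ε hε => ?_⟩, fun hp' => ⟨?_, ?_⟩⟩
  · rw [← ENNReal.tendsto_toReal_iff (fun n => measure_ne_top _ _) ENNReal.zero_ne_top]
    refine (RandomAngles.tendsto_real_le_signedMin h1 hunif hindep hp hε).congr fun n => ?_
    simp_rw [RandomAngles.Θmin_eq_signedMin, sub_zero,
      abs_of_nonneg (RandomAngles.signedMin_nonneg _ _)]
    rfl
  · rw [← ENNReal.tendsto_toReal_iff (fun n => measure_ne_top _ _) ENNReal.zero_ne_top]
    refine (RandomAngles.tendsto_real_le_signedMin h2 hunif hindep hp hε).congr' ?_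
    filter_upwards [eventually_ge_atTop 2] with n hn
    simp_rw [RandomAngles.Θmax_eq_pi_sub_signedMin hn, sub_sub_cancel_left, abs_neg,
      abs_of_nonneg (RandomAngles.signedMin_nonneg _ _)]
    rfl
  · simp_rw [RandomAngles.Θmin_eq_signedMin]
    exact RandomAngles.convergesWeakly_extremeCDF
      (fun n => ((RandomAngles.measurable_normalized _ _).comp
        (RandomAngles.measurable_signedMin _ _ _)).comp_aemeasurable (hX n))
      (RandomAngles.tendsto_real_lt_normalized_signedMin h1 hunif hindep hp hp')
  · refine RandomAngles.convergesWeakly_extremeCDF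
      (fun n => ((RandomAngles.measurable_normalized _ _).comp
        (RandomAngles.measurable_Θmax _ _)).comp_aemeasurable (hX n)) fun y => ?_
    refine (RandomAngles.tendsto_real_lt_normalized_signedMin h2 hunif hindep hp hp' y).congr' ?_
    filter_upwards [eventually_ge_atTop 2] with n hn
    simp_rw [RandomAngles.Θmax_eq_pi_sub_signedMin hn, RandomAngles.normalized, Real.sin_pi_sub]
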